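/- Let $X$ be a (Hausdorff) complex surface with a nowhere vanishing holomorphic $2$-form $\eta$, let $n\ge 2$, and let $E=E_1\cup\dots\cup E_n\subset X$ be a configuration of $(-2)$-curves (equivalently, as $\eta$ exists, smooth rational curves) whose dual graph is the Dynkin diagram $\mathrm{A}_n$: $E_i$ and $E_{i+1}$ meet transversally in a single point, and $E_i\cap E_j=\emptyset$ if $|i-j|\ge 2$. Let $f$ be a biholomorphic map from a neighbourhood of $E$ onto a neighbourhood of $E$ with $f(E)=E$ and $f^*\eta=\delta\,\eta$ for a constant $\delta$ that is not a root of unity. Suppose that $E$ has reflectional symmetry, that is, the automorphism $\sigma$ of the diagram $\mathrm{A}_n$ given by $f(E_i)=E_{\sigma(i)}$ has order $2$. (For instance, $E$ is an $f$-invariant exceptional component of type $\mathrm{A}_n$ with reflectional symmetry for an automorphism $f$ of a K3 surface whose twist number $\delta$ is conjugate to a Salem number and whose Picard group is non-degenerate, or the exceptional set of a minimal resolution of a Kleinian singularity of type $\mathrm{A}_n$.) Fix a square root $\delta^{1/2}$ and put $\hat\tau:=\delta^{1/2}+\delta^{-1/2}$. Let $H_k,K_k\in\mathbb{Z}[w]$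 be the polynomials with $H_k(z+z^{-1})=z^k+z^{-k}$ and $z^{k+1}-z^{-(k+1)}=(z-z^{-1})K_k(z+z^{-1})$ for $k\ge 0$. For an integer $m\ge 1$ let $\mathrm{Fix}^{\mathrm{i}}(f^m,E)$ be the set of points of $E$ that are isolated fixed points of $f^m$, and $N(f^m,E)$ the number of curves $E_i$ fixed pointwise by $f^m$. At $p\in \mathrm{Fix}^{\mathrm{i}}(f^m,E)$, with a local chart $z=(z_1,z_2)$, $p:z=0$, in which $f^m$ is $(g_1,g_2)$, put $$\mu(f^m,p)=\dim_{\mathbb{C}}\mathbb{C}\{z_1,z_2\}/(z_1-g_1,\,z_2-g_2),\qquad \nu(f^m,p)=\operatorname{Res}_p\frac{dz_1\wedge dz_2}{(z_1-g_1)(z_2-g_2)}$$ (Grothendieck residue), and set $$\mu(f^m,E)=\sum_{p\in \mathrm{Fix}^{\mathrm{i}}(f^m,E)}\mu(f^m,p)+2N(f^m,E),\qquad \hat\nu(f^m,E)=\sum_{p\in \mathrm{Fix}^{\mathrm{i}}(f^m,E)}\delta^{m/2}\,\nu(f^m,p)+N(f^m,E)\,\delta^{m/2}\frac{\delta^m+1}{(\delta^m-1)^2}.$$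 Then for every integer $m\ge 1$ the set $\mathrm{Fix}^{\mathrm{i}}(f^m,E)$ is finite, and $$\mu(f^m,E)=\begin{cases}1&\text{if } m \text{ is odd and } n \text{ is even},\\ 2&\text{if } m \text{ is odd and } n \text{ is odd},\\ n+1&\text{if } m \text{ is even},\end{cases} \qquad \hat\nu(f^m,E)=\begin{cases}\dfrac{1}{H_m(\hat\tau)}&\text{if } m \text{ is odd},\\[3mm] \dfrac{K_n(H_m(\hat\tau))}{H_{m(n+1)}(\hat\tau)-2(-1)^{(m/2)(n+1)}}&\text{if } m \text{ is even},\end{cases}$$ where the denominators do not vanish. -/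

import Mathlib

open scoped Manifold ContDiff Topology

noncomputable section

namespace TypeAComponent

/-! ### The polynomials `H_n` and `K_n` -/

/-- `H_n ∈ ℤ[w]`, the polynomial with `H_n (z + z⁻¹) = z ^ n + z⁻¹ ^ n`
(that is, `H_n (w) = 2 T_n (w / 2)`). -/
def H (n : ℕ) : Polynomial ℤ := Polynomial.Chebyshev.C ℤ n

/-- `K_n ∈ ℤ[w]`, the polynomial with
`z ^ (n + 1) - z⁻¹ ^ (n + 1) = (z - z⁻¹) K_n (z + z⁻¹)` (that is, `K_n (w) = U_n (w / 2)`). -/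
def K (n : ℕ) : Polynomial ℤ := Polynomial.Chebyshev.S ℤ n

theorem aeval_H (z : ℂ) (hz : z ≠ 0) (n : ℕ) :
    Polynomial.aeval (z + z⁻¹) (H n) = z ^ n + z⁻¹ ^ n := by
  have hw : z * z⁻¹ = 1 := mul_inv_cancel₀ hz
  induction n using Nat.twoStepInduction with
  | zero => simpa [H, one_add_one_eq_two] using map_ofNat (Polynomial.aeval (z + z⁻¹)) 2
  | one => simp [H]
  | more n h0 h1 =>
    have e : H (n + 2) = Polynomial.X * H (n + 1) - H n := by simp [H]
    rw [e, map_sub, map_mul, Polynomial.aeval_X, h0, h1]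
    linear_combination (z ^ n + z⁻¹ ^ n) * hw

theorem aeval_K (z : ℂ) (hz : z ≠ 0) (n : ℕ) :
    (z - z⁻¹) * Polynomial.aeval (z + z⁻¹) (K n) = z ^ (n + 1) - z⁻¹ ^ (n + 1) := by
  have hw : z * z⁻¹ = 1 := mul_inv_cancel₀ hz
  induction n using Nat.twoStepInduction with
  | zero => simp [K]
  | one =>
    simp only [K, Nat.cast_one, Polynomial.Chebyshev.S_one, Polynomial.aeval_X]
    ring
  | more n h0 h1 =>
    have e : K (n + 2) = Polynomial.X * K (n + 1) - K n := by simp [K]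
    rw [e, map_sub, map_mul, Polynomial.aeval_X, mul_sub, mul_left_comm, h0, h1]
    linear_combination (z ^ (n + 1) - z⁻¹ ^ (n + 1)) * hw

/-! ### Local multiplicity and Grothendieck residue of a zero of a map `ℂ² → ℂ²` -/

/-- The coordinate plane on which complex surfaces are modelled. -/
abbrev Plane : Type := Fin 2 → ℂ

/-- The algebra of functions that are holomorphic near `a`. -/
def analyticFunctions (a : Plane) : Subalgebra ℂ (Plane → ℂ) where
  carrier := {h | AnalyticAt ℂ h a}
  mul_mem' := fun hh hk => AnalyticAt.mul hh hk
  add_mem' := fun hh hk => AnalyticAt.add hh hk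
  algebraMap_mem' := fun _ => analyticAt_const

/-- The ideal of functions that vanish near `a`. -/
def nullIdeal (a : Plane) : Ideal (analyticFunctions a) where
  carrier := {h | ∀ᶠ z in 𝓝 a, (h : Plane → ℂ) z = 0}
  add_mem' := fun hh hk => by
    filter_upwards [hh, hk] with z h1 h2
    simp [h1, h2]
  zero_mem' := Filter.Eventually.of_forall fun _ => rfl
  smul_mem' := fun c h hh => by
    filter_upwards [hh] with z h1
    simp [h1]

/-- The ring `𝒪_a ≅ ℂ{z₁, z₂}` of germs at `a` of holomorphic functions. -/
abbrev germRing (a : Plane) : Type := analyticFunctions a ⧸ nullIdeal a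

/-- The ideal `(g₁, g₂)` of `𝒪_a` generated by the germs of the components of `g`. -/
def componentIdeal (g : Plane → Plane) (a : Plane) : Ideal (germRing a) :=
  Ideal.span {φ | ∃ h : analyticFunctions a, ∃ i : Fin 2,
    (∀ᶠ z in 𝓝 a, (h : Plane → ℂ) z = g z i) ∧ φ = Ideal.Quotient.mk (nullIdeal a) h}

/-- The multiplicity `dim_ℂ 𝒪_a / (g₁, g₂) ∈ ℕ ∪ {∞}`. -/
def multiplicity (g : Plane → Plane) (a : Plane) : ℕ∞ :=
  Cardinal.toENat (Module.rank ℂ (germRing a ⧸ componentIdeal g a))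

/-- The integral of `dz₁ ∧ dz₂ / (g₁ g₂)` over the cycle
`Γ = {z ∈ U : |g₁ z| = ε₁, |g₂ z| = ε₂}`, oriented by `d arg g₁ ∧ d arg g₂ ≥ 0`.
It is written in the coordinates `w = g z` of `Γ`, in which
`dz₁ ∧ dz₂ = dw₁ ∧ dw₂ / det g' z`: the integral over the torus `|w₁| = ε₁`, `|w₂| = ε₂` of the
sum over the points `z ∈ U` above `w` (the critical values of `g` are negligible). -/
def cycleIntegral (g : Plane → Plane) (U : Set Plane) (ε : Fin 2 → ℝ) : ℂ :=
  torusIntegral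
    (fun w => ∑ᶠ z ∈ {z | z ∈ U ∧ g z = w}, ((fderiv ℂ g z).det)⁻¹ * (w 0 * w 1)⁻¹) 0 ε

/-- `c` is the Grothendieck residue `Res_a dz₁ ∧ dz₂ / (g₁ g₂)`, that is,
`(2πi)⁻² ∫_Γ dz₁ ∧ dz₂ / (g₁ g₂)` for every small neighbourhood `U` of `a` in a basis, and
then for every small `(ε₁, ε₂)`. -/
def IsResidue (g : Plane → Plane) (a : Plane) (c : ℂ) : Prop :=
  ∀ᶠ r in 𝓝[>] (0 : ℝ), ∀ᶠ ε in 𝓝[{ε : Fin 2 → ℝ | ∀ i, 0 < ε i}] 0,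
    ((2 * Real.pi * Complex.I) ^ 2)⁻¹ * cycleIntegral g (Metric.ball a r) ε = c

open Classical in
/-- The Grothendieck residue `Res_a dz₁ ∧ dz₂ / (g₁ g₂)` at an isolated zero `a` of `g`. -/
def residue (g : Plane → Plane) (a : Plane) : ℂ :=
  if h : ∃ c, IsResidue g a c then h.choose else 0

/-! ### Complex surfaces -/

variable {X : Type*} [TopologicalSpace X] [ChartedSpace Plane X] [IsManifold 𝓘(ℂ, Plane) ω X]

/-- The map `z ↦ z - f z` in the chart at the fixed point `p` of `f`. -/
def displacement (f : X → X) (p : X) (z : Plane) : Plane :=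
  z - writtenInExtChartAt 𝓘(ℂ, Plane) 𝓘(ℂ, Plane) p f z

/-- The topological local index `μ(f, p)`. -/
def mu (f : X → X) (p : X) : ℕ∞ :=
  multiplicity (displacement f p) (extChartAt 𝓘(ℂ, Plane) p p)

/-- The holomorphic local index `ν(f, p)`. -/
def nu (f : X → X) (p : X) : ℂ :=
  residue (displacement f p) (extChartAt 𝓘(ℂ, Plane) p p)

/-- A nowhere vanishing holomorphic `2`-form on the surface `X`: a holomorphic section of the
bundle of bilinear forms on the tangent bundle, alternating and nonzero at every point. -/
structure IsHolomorphicAreaForm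
    (η : ∀ x : X, TangentSpace 𝓘(ℂ, Plane) x →L[ℂ] TangentSpace 𝓘(ℂ, Plane) x →L[ℂ] ℂ) :
    Prop where
  holomorphic : ContMDiff 𝓘(ℂ, Plane) (𝓘(ℂ, Plane).prod 𝓘(ℂ, Plane →L[ℂ] Plane →L[ℂ] ℂ)) ω
    (fun x => Bundle.TotalSpace.mk' (Plane →L[ℂ] Plane →L[ℂ] ℂ)
      (E := fun x : X => TangentSpace 𝓘(ℂ, Plane) x →L[ℂ] TangentSpace 𝓘(ℂ, Plane) x →L[ℂ] ℂ)
      x (η x))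
  alternating : ∀ x v, η x v v = 0
  ne_zero : ∀ x, η x ≠ 0

/-- `C` is a smooth rational curve in `X`, the image of a holomorphic embedding of `ℙ¹`. The
embedding is given by its restrictions `u`, `v` to the two affine charts of `ℙ¹`, which are
glued by `t = 1 / s`. (On a surface with a nowhere vanishing holomorphic `2`-form these curves
are precisely the `(-2)`-curves, by the adjunction formula.) -/
def IsSmoothRationalCurve (C : Set X) : Prop :=
  ∃ u v : ℂ → X,
    ContMDiff 𝓘(ℂ) 𝓘(ℂ, Plane) ω u ∧ ContMDiff 𝓘(ℂ) 𝓘(ℂ, Plane) ω v ∧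
    (∀ s : ℂ, s ≠ 0 → v s = u s⁻¹) ∧
    Function.Injective u ∧ v 0 ∉ Set.range u ∧
    (∀ s : ℂ, mfderiv 𝓘(ℂ) 𝓘(ℂ, Plane) u s ≠ 0) ∧ mfderiv 𝓘(ℂ) 𝓘(ℂ, Plane) v 0 ≠ 0 ∧
    C = insert (v 0) (Set.range u)

/-- The tangent vectors at `p` of the curve `C`: velocities of holomorphic arcs in `C`. -/
def tangentVectors (C : Set X) (p : X) : Set Plane :=
  {w | ∃ γ : ℂ → X, γ 0 = p ∧ ContMDiffAt 𝓘(ℂ) 𝓘(ℂ, Plane) ω γ 0 ∧ (∀ᶠ t in 𝓝 0, γ t ∈ C) ∧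
    (mfderiv 𝓘(ℂ) 𝓘(ℂ, Plane) γ 0 (1 : ℂ) : Plane) = w}

/-- `E` is a configuration of smooth rational curves `E₁, …, E_n` whose dual graph is the Dynkin
diagram `A_n`: neighbouring curves meet transversally in a single point, others are disjoint. -/
structure IsTypeA {n : ℕ} (E : Fin n → Set X) : Prop where
  curve : ∀ i, IsSmoothRationalCurve (E i)
  adjacent : ∀ i j, (SimpleGraph.pathGraph n).Adj i j →
    ∃ p, E i ∩ E j = {p} ∧ tangentVectors (E i) p ∩ tangentVectors (E j) p ⊆ {0}
  disjoint : ∀ i j, i ≠ j → ¬ (SimpleGraph.pathGraph n).Adj i j → Disjoint (E i) (E j)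

/-- `f` is an automorphism of a neighbourhood germ of the set `S`, with twist number `δ`: it is
biholomorphic from an open neighbourhood `V` of `S` onto its image, and `f^* η = δ η` on `V`. The
values of `f` away from `S` are irrelevant. -/
def IsAutomorphismNear (f : X → X) (S : Set X)
    (η : ∀ x : X, TangentSpace 𝓘(ℂ, Plane) x →L[ℂ] TangentSpace 𝓘(ℂ, Plane) x →L[ℂ] ℂ)
    (δ : ℂ) : Prop :=
  f '' S = S ∧
  ∃ V : Set X, IsOpen V ∧ S ⊆ V ∧ Set.InjOn f V ∧
    ContMDiffOn 𝓘(ℂ, Plane) 𝓘(ℂ, Plane) ω f V ∧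
    ∀ x ∈ V, ∀ v w : TangentSpace 𝓘(ℂ, Plane) x,
      η (f x) (mfderiv 𝓘(ℂ, Plane) 𝓘(ℂ, Plane) f x v)
        (mfderiv 𝓘(ℂ, Plane) 𝓘(ℂ, Plane) f x w) = δ * η x v w

/-- The diagram automorphism `σ(f, E)`, given by `f(E_i) = E_{σ i}`, has order `2`. -/
def HasReflectionalSymmetry {n : ℕ} (f : X → X) (E : Fin n → Set X) : Prop :=
  ∃ σ : SimpleGraph.pathGraph n ≃g SimpleGraph.pathGraph n,
    (∀ i, f '' E i = E (σ i)) ∧ orderOf σ = 2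

/-! ### Indices of an exceptional component -/

/-- The fixed points of `f` on `⋃ E_i` that are isolated among the fixed points of `f` in `X`. -/
def isolatedFixedPoints {n : ℕ} (f : X → X) (E : Fin n → Set X) : Set X :=
  {p | p ∈ ⋃ i, E i ∧ f p = p ∧ ∀ᶠ q in 𝓝[≠] p, f q ≠ q}

/-- The number `N(f, E)` of curves `E_i` that are fixed pointwise by `f`. -/
def fixedCurves {n : ℕ} (f : X → X) (E : Fin n → Set X) : ℕ :=
  {i : Fin n | ∀ p ∈ E i, f p = p}.ncard

/-- `μ(f, E)`. -/
def muE {n : ℕ} (f : X → X) (E : Fin n → Set X) : ℕ∞ :=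
  (∑ᶠ p ∈ isolatedFixedPoints f E, mu f p) + 2 * (fixedCurves f E : ℕ∞)

/-- `ν̂(f, E)`, where `β = δ(f)^{1/2}` is the chosen square root of the twist number of `f`. -/
def nuHatE {n : ℕ} (f : X → X) (E : Fin n → Set X) (β : ℂ) : ℂ :=
  (∑ᶠ p ∈ isolatedFixedPoints f E, β * nu f p) +
    (fixedCurves f E : ℂ) * (β * ((β ^ 2 + 1) / (β ^ 2 - 1) ^ 2))

end TypeAComponent

end

noncomputable section

namespace TypeAComponent

/-! ### Multiplicity and Grothendieck residue at a nondegenerate zero -/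

section

/-! An automorphism of the path of order 2 is the reversal (`pathGraph_aut_apply_eq_rev`), so `f`
flips the chain. Put `g = f^m`, `d = δ^m` and `B = δ^(m/2)`. All indices are read off from the
eigenvalues of `Dg` at fixed points. Three facts control these. An injective holomorphic map between
smooth rational curves, with nonzero derivative at `∞` and sending `∞` to `∞`, is affine
(`IsParam.exists_affine`), so a self-map of a curve has reciprocal multipliers at two fixed points.
Since `g^* η = d η`, the eigenvalues of `Dg` at a fixed point have product `d`. At a fixed point
with `det (1 - Dg) ≠ 0` one has `μ = 1` and `ν = 1 / det (1 - Dg)` (`multiplicity_eq_one`,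
`residue_eq_inv_det`). Every isolated fixed point on `E` turns out to be of this kind.

If `m` is odd, `g` flips the chain too, and a fixed point must lie on a curve and on its mirror
image. For `n` even this leaves the central node, where `Dg` exchanges the two tangent lines and
`det (1 - Dg) = 1 + d`. For `n` odd it leaves the two fixed points of an involution of the central
curve, each with multiplier `-1` and `det (1 - Dg) = 2 (1 + d)`. In both cases the sum of `ν` is `1
/ (1 + d)`.

If `m` is even, `g` preserves each curve and fixes the nodes. The two facts on multipliers give a
geometric progression of ratio `B ^ 2` along the chain. The centre fixes its initial value: there
the square of `f` has multiplier `-δ` at the central node (`n` even) or is the identity on the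
central curve (`n` odd). Since `B` is not a root of unity, only the central curve of an odd chain
can have multiplier 1, so each end curve carries one further fixed point. This yields `n + 1` points
`q 0, …, q n` (`exists_isFixedChain`). Their contributions to `ν̂` telescope (`index_term_eq`). When
the central curve is pointwise fixed, two of the points cease to be isolated, and the term for a
fixed curve is exactly what they would have contributed to the telescoping sum.

The hypotheses do not say that `δ ≠ 0`; this follows from injectivity of `f`
(`IsSelfMap.twist_ne_zero`). -/

theorem exists_analyticAt_eq_add_apply {V : Type*} [NormedAddCommGroup V] [NormedSpace ℂ V]
    {F : V → ℂ} (hF : AnalyticAt ℂ F 0) :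
    ∃ G : V → V →L[ℂ] ℂ, AnalyticAt ℂ G 0 ∧ ∀ᶠ w in 𝓝 0, F w = F 0 + G w w := by
  obtain ⟨p, hp⟩ := hF
  have hrad : 0 < p.shift.radius := by
    rw [FormalMultilinearSeries.radius_shift]; exact hp.radius_pos
  -- The series of `G` is obtained by splitting off the last argument of each coefficient; `unshift`
  -- puts it back.
  have hG := p.shift.hasFPowerSeriesOnBall hrad
  have hr' := hG.unshift (z := F 0)
  have hpp : p.shift.unshift (F 0) = p := by
    ext1 n
    cases n with
    | zero =>
      ext v
      have := hp.coeff_zero v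
      simp [FormalMultilinearSeries.unshift, this]
    | succ n =>
      exact LinearIsometryEquiv.symm_apply_apply (continuousMultilinearCurryRightEquiv' ℂ n V ℂ) _
  rw [hpp] at hr'
  refine ⟨p.shift.sum, hG.analyticAt, ?_⟩
  obtain ⟨r, hr⟩ := hp
  set r' := p.shift.radius
  have hb : Metric.eball (0 : V) (min r r') ∈ 𝓝 0 :=
    Metric.eball_mem_nhds _ (lt_min hr.r_pos hr'.r_pos)
  filter_upwards [hb] with w hw
  have h1 := (hr.mono (lt_min hr.r_pos hr'.r_pos) (min_le_left _ _)).sum hw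
  have h2 := (hr'.mono (lt_min hr.r_pos hr'.r_pos) (min_le_right _ _)).sum hw
  have h3 := hr.hasSum (y := w) (by simpa using Metric.eball_subset_eball (min_le_left _ _) hw)
  have h4 := hr'.hasSum (y := w) (by simpa using Metric.eball_subset_eball (min_le_right _ _) hw)
  simpa using h3.unique h4

theorem det_eq_sub (A : Plane →L[ℂ] Plane) :
    A.det = A (Pi.single 0 1) 0 * A (Pi.single 1 1) 1 -
      A (Pi.single 1 1) 0 * A (Pi.single 0 1) 1 := by
  rw [ContinuousLinearMap.det, ← LinearMap.det_toMatrix', Matrix.det_fin_two]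
  simp [LinearMap.toMatrix'_apply]

/-- The derivative as an equivalence. -/
def derivEquiv {g : Plane → Plane} {a : Plane} (hdet : (fderiv ℂ g a).det ≠ 0) :
    Plane ≃L[ℂ] Plane :=
  (fderiv ℂ g a).toContinuousLinearEquivOfDetNeZero hdet

theorem hasStrictFDerivAt_derivEquiv {g : Plane → Plane} {a : Plane} (hg : AnalyticAt ℂ g a)
    (hdet : (fderiv ℂ g a).det ≠ 0) :
    HasStrictFDerivAt g (derivEquiv hdet : Plane →L[ℂ] Plane) a := by
  rw [derivEquiv, ContinuousLinearMap.coe_toContinuousLinearEquivOfDetNeZero]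
  exact hg.hasStrictFDerivAt

theorem exists_localInverse {g : Plane → Plane} {a : Plane} (hg : AnalyticAt ℂ g a)
    (hga : g a = 0) (hdet : (fderiv ℂ g a).det ≠ 0) :
    ∃ φ : OpenPartialHomeomorph Plane Plane, (φ : Plane → Plane) = g ∧ a ∈ φ.source ∧
      AnalyticAt ℂ φ.symm 0 := by
  have h := hasStrictFDerivAt_derivEquiv hg hdet
  refine ⟨h.toOpenPartialHomeomorph g, rfl, h.mem_toOpenPartialHomeomorph_source, ?_⟩
  rw [← hga]
  exact (hg.contDiffAt.to_localInverse h.hasFDerivAt (n := ω) (by simp)).analyticAt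

/-- Under these hypotheses `S` generates the image of the kernel of the character `e`, so the
quotient is `ℂ`. -/
theorem rank_quotient_eq_one {A : Type*} [CommRing A] [Algebra ℂ A] (N : Ideal A)
    (S : Set (A ⧸ N)) (e : A →ₐ[ℂ] ℂ) (hN : ∀ x ∈ N, e x = 0)
    (hS : ∀ x, Ideal.Quotient.mk N x ∈ S → e x = 0)
    (h : ∀ x, e x = 0 → Ideal.Quotient.mk N x ∈ Ideal.span S) :
    Module.rank ℂ ((A ⧸ N) ⧸ Ideal.span S) = 1 := by
  refine rank_eq_one (1 : (A ⧸ N) ⧸ Ideal.span S) ?_ ?_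
  · rw [Ne, ← map_one (Ideal.Quotient.mk (Ideal.span S)), Ideal.Quotient.eq_zero_iff_mem]
    intro h1
    have hle : Ideal.span S ≤ RingHom.ker (Ideal.Quotient.lift N (e : A →+* ℂ) hN) := by
      rw [Ideal.span_le]
      intro y hy
      obtain ⟨x, rfl⟩ := Ideal.Quotient.mk_surjective y
      exact hS x hy
    have := hle h1
    rw [RingHom.mem_ker, map_one] at this
    exact one_ne_zero this
  · intro y
    obtain ⟨y, rfl⟩ := Ideal.Quotient.mk_surjective y
    obtain ⟨x, rfl⟩ := Ideal.Quotient.mk_surjective y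
    refine ⟨e x, ?_⟩
    have hx := h (algebraMap ℂ A (e x) - x) (by simp)
    rw [← Ideal.Quotient.eq_zero_iff_mem, map_sub, map_sub, sub_eq_zero] at hx
    rw [← hx, Algebra.algebraMap_eq_smul_one]
    rfl

/-- Evaluation at `a` of functions that are holomorphic near `a`. -/
def evalAt (a : Plane) : analyticFunctions a →ₐ[ℂ] ℂ :=
  (Pi.evalAlgHom ℂ (fun _ : Plane => ℂ) a).comp (analyticFunctions a).val

/-- Since `g` is a local coordinate system, a germ vanishing at `a` is a function of `w = g z`
vanishing at `w = 0`, hence of the form `∑ cᵢ gᵢ`. Thus `(g₁, g₂)` is the maximal ideal. -/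
theorem multiplicity_eq_one {g : Plane → Plane} {a : Plane} (hg : AnalyticAt ℂ g a)
    (hga : g a = 0) (hdet : (fderiv ℂ g a).det ≠ 0) : multiplicity g a = 1 := by
  obtain ⟨φ, hφg, ha, hφ⟩ := exists_localInverse hg hga hdet
  have hφ0 : φ.symm 0 = a := by rw [← hga, ← hφg]; exact φ.left_inv ha
  have hgi : ∀ i, AnalyticAt ℂ (fun z => g z i) a := fun i =>
    ((ContinuousLinearMap.proj (R := ℂ) (φ := fun _ : Fin 2 => ℂ) i).analyticAt _).comp hg
  have key : Module.rank ℂ (germRing a ⧸ componentIdeal g a) = 1 := by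
    refine rank_quotient_eq_one (nullIdeal a) _ (evalAt a) (fun x hx => hx.self_of_nhds) ?_ ?_
    · rintro x ⟨h, i, hh, hx⟩
      have hd := (Ideal.Quotient.eq.1 hx : ∀ᶠ z in 𝓝 a, _).self_of_nhds
      have hz := hh.self_of_nhds
      simp only [hga, Pi.zero_apply] at hz
      change (x : Plane → ℂ) a - (h : Plane → ℂ) a = 0 at hd
      change (x : Plane → ℂ) a = 0
      rw [← hd, hz, sub_zero]
    · intro x hx
      have hx0 : (x : Plane → ℂ) a = 0 := hx
      have hxa : AnalyticAt ℂ (x : Plane → ℂ) (φ.symm 0) := by rw [hφ0]; exact x.2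
      obtain ⟨G, hG, hGx⟩ := exists_analyticAt_eq_add_apply (hxa.comp hφ)
      rw [← hga] at hG hGx
      have hGg : AnalyticAt ℂ (fun z => G (g z)) a := hG.comp hg
      let c : Fin 2 → analyticFunctions a := fun i =>
        ⟨fun z => G (g z) (Pi.single i 1),
          ((ContinuousLinearMap.apply ℂ ℂ (Pi.single i 1 : Plane)).analyticAt _).comp hGg⟩
      let k : Fin 2 → analyticFunctions a := fun i => ⟨fun z => g z i, hgi i⟩
      have hxe : Ideal.Quotient.mk (nullIdeal a) x =
          ∑ i, Ideal.Quotient.mk (nullIdeal a) (c i) * Ideal.Quotient.mk (nullIdeal a) (k i) := by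
        simp only [← map_mul, ← map_sum]
        refine Ideal.Quotient.eq.2 ?_
        change ∀ᶠ z in 𝓝 a, _
        filter_upwards [hg.continuousAt.eventually hGx, φ.open_source.mem_nhds ha] with z hz hzs
        have hzz : φ.symm (g z) = z := by rw [← hφg]; exact φ.left_inv hzs
        rw [hga] at hz
        simp only [Function.comp_apply, hzz, hφ0, hx0, zero_add] at hz
        have hdec : g z = ∑ i, g z i • (Pi.single i 1 : Plane) := by
          ext j; fin_cases j <;> simp
        change (x : Plane → ℂ) z - _ = 0
        rw [hz, sub_eq_zero]
        obtain ⟨T, hT⟩ : ∃ T, G (g z) = T := ⟨_, rfl⟩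
        rw [hT]
        conv_lhs => rw [hdec]
        simp [c, k, hT, Fin.sum_univ_two, mul_comm]
      rw [hxe]
      refine Ideal.sum_mem _ fun i _ => Ideal.mul_mem_left _ _ (Ideal.subset_span ?_)
      exact ⟨k i, i, Filter.Eventually.of_forall fun _ => rfl, rfl⟩
  rw [multiplicity, key]; simp

/-- The residue is defined by choice, so its uniqueness is needed: both filters are nontrivial, the
second because `0` lies in the closure of the open quadrant. -/
theorem residue_eq_of_isResidue {g : Plane → Plane} {a : Plane} {c : ℂ} (h : IsResidue g a c) :
    residue g a = c := by
  have hex : ∃ c, IsResidue g a c := ⟨c, h⟩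
  rw [residue, dif_pos hex]
  have : (𝓝[{ε : Fin 2 → ℝ | ∀ i, 0 < ε i}] 0).NeBot := by
    rw [← mem_closure_iff_nhdsWithin_neBot]
    have : {ε : Fin 2 → ℝ | ∀ i, 0 < ε i} = Set.univ.pi fun _ => Set.Ioi 0 := by ext; simp
    rw [this, closure_pi_set]
    simp [Pi.le_def]
  obtain ⟨r, hr, hr'⟩ := (hex.choose_spec.and h).exists
  obtain ⟨ε, hε, hε'⟩ := (hr.and hr').exists
  exact hε.symm.trans hε'

/-- Cauchy's formula at the centre of a bidisc, from the one-variable formula applied in each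
coordinate in turn. -/
theorem torusIntegral_cauchy {F : Plane → ℂ} {ρ : ℝ}
    (hF : DifferentiableOn ℂ F (Metric.ball 0 ρ)) {ε : Fin 2 → ℝ} (hε : ∀ i, 0 < ε i)
    (hερ : ∀ i, ε i < ρ) :
    torusIntegral (fun w => F w * (w 0 * w 1)⁻¹) 0 ε = (2 * Real.pi * Complex.I) ^ 2 * F 0 := by
  have hρ : 0 < ρ := (hε 0).trans (hερ 0)
  have hmem : ∀ w : Plane, ‖w 0‖ < ρ → ‖w 1‖ < ρ → w ∈ Metric.ball (0 : Plane) ρ := by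
    intro w h0 h1
    rw [mem_ball_zero_iff, pi_norm_lt_iff hρ]
    intro i; fin_cases i <;> assumption
  have hnorm : ∀ θ i, ‖torusMap (0 : Plane) ε θ i‖ = ε i := by
    intro θ i
    simp [torusMap, Complex.norm_exp, abs_of_pos (hε i)]
  have hint : TorusIntegrable (fun w : Plane => F w * (w 0 * w 1)⁻¹) 0 ε := by
    refine ContinuousOn.integrableOn_compact isCompact_Icc (Continuous.continuousOn ?_)
    have hT : Continuous fun θ => torusMap (0 : Plane) ε θ := by
      unfold torusMap; fun_prop
    refine Continuous.mul ?_ (Continuous.inv₀ (by fun_prop) ?_)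
    · exact hF.continuousOn.comp_continuous hT fun θ =>
        hmem _ (by rw [hnorm]; exact hερ 0) (by rw [hnorm]; exact hερ 1)
    · intro θ h
      rcases mul_eq_zero.1 h with h | h <;>
        exact (hε _).ne' ((hnorm θ _).symm.trans (norm_eq_zero.2 h))
  rw [torusIntegral_succ hint]
  have inner : ∀ x : ℂ, ‖x‖ < ρ → (∮ z in C(0, ε 1), F ![x, z] * (x * z)⁻¹) =
      2 * Real.pi * Complex.I * F ![x, 0] * x⁻¹ := by
    intro x hx
    have hd : DifferentiableOn ℂ (fun z => F ![x, z]) (Metric.closedBall 0 (ε 1)) := by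
      refine hF.comp (t := Metric.ball 0 ρ) (f := fun z : ℂ => (![x, z] : Plane)) ?_ ?_
      · refine Differentiable.differentiableOn ?_
        rw [differentiable_pi]
        intro i; fin_cases i <;> simp
      · intro z hz
        exact hmem _ hx ((mem_closedBall_zero_iff.1 hz).trans_lt (hερ 1))
    have := hd.circleIntegral_sub_inv_smul (w := 0) (by simp [hε 1])
    simp only [sub_zero, smul_eq_mul] at this
    rw [← this, mul_comm _ x⁻¹, ← smul_eq_mul, ← circleIntegral.integral_smul]
    congr 1; ext z; simp; ring
  have outer : (∮ x in C(0, ε 0), 2 * Real.pi * Complex.I * F ![x, 0] * x⁻¹) =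
      (2 * Real.pi * Complex.I) ^ 2 * F 0 := by
    have hd : DifferentiableOn ℂ (fun z => F ![z, 0]) (Metric.closedBall 0 (ε 0)) := by
      refine hF.comp (t := Metric.ball 0 ρ) (f := fun z : ℂ => (![z, 0] : Plane)) ?_ ?_
      · refine Differentiable.differentiableOn ?_
        rw [differentiable_pi]
        intro i; fin_cases i <;> simp
      · intro z hz
        exact hmem _ ((mem_closedBall_zero_iff.1 hz).trans_lt (hερ 0)) (by simpa using hρ)
    have := hd.circleIntegral_sub_inv_smul (w := 0) (by simp [hε 0])
    simp only [sub_zero, smul_eq_mul] at this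
    have h0 : (![0, 0] : Plane) = 0 := by ext i; fin_cases i <;> rfl
    rw [h0] at this
    rw [sq, mul_assoc (2 * Real.pi * Complex.I : ℂ), ← this, ← circleIntegral.integral_const_mul]
    congr 1; ext z; ring
  rw [← outer]
  refine circleIntegral.integral_congr (hε 0).le fun x hx => ?_
  rw [torusIntegral_dim1]
  have hx' : ‖x‖ < ρ := by
    rw [mem_sphere_zero_iff_norm.1 hx]; exact hερ 0
  rw [← inner x hx']
  refine circleIntegral.integral_congr (hε 1).le fun z _ => ?_
  have : (Fin.cons x (fun _ => z) : Plane) = ![x, z] := by ext i; fin_cases i <;> rfl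
  simp only [this]
  rfl

/-- Over a small torus the fibre of `g` in the ball is the single point `φ.symm w`, so the cycle
integral is the Cauchy integral of `1 / det g'` pulled back by the local inverse. -/
theorem residue_eq_inv_det {g : Plane → Plane} {a : Plane} (hg : AnalyticAt ℂ g a)
    (hga : g a = 0) (hdet : (fderiv ℂ g a).det ≠ 0) :
    residue g a = ((fderiv ℂ g a).det)⁻¹ := by
  obtain ⟨φ, hφg, ha, hφ⟩ := exists_localInverse hg hga hdet
  have hφ0 : φ.symm 0 = a := by rw [← hga, ← hφg]; exact φ.left_inv ha
  have h0t : (0 : Plane) ∈ φ.target := by rw [← hga, ← hφg]; exact φ.map_source ha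
  refine residue_eq_of_isResidue ?_
  have hsrc := Metric.mem_nhds_iff.1 (φ.open_source.mem_nhds ha)
  obtain ⟨R, hR, hRs⟩ := hsrc
  filter_upwards [Ioo_mem_nhdsGT hR] with r hr
  have hdetan : AnalyticAt ℂ (fun z => (fderiv ℂ g z).det) a := by
    simp only [det_eq_sub]
    have h : ∀ i j : Fin 2, AnalyticAt ℂ (fun z => fderiv ℂ g z (Pi.single i 1) j) a := fun i j =>
      (((ContinuousLinearMap.proj (R := ℂ) (φ := fun _ : Fin 2 => ℂ) j).comp
        (ContinuousLinearMap.apply ℂ Plane (Pi.single i 1 : Plane))).analyticAt _).comp hg.fderiv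
    exact ((h 0 0).mul (h 1 1)).sub ((h 1 0).mul (h 0 1))
  have hF : ∀ᶠ w in 𝓝 0, AnalyticAt ℂ (fun w => ((fderiv ℂ g (φ.symm w)).det)⁻¹) w := by
    refine AnalyticAt.eventually_analyticAt (AnalyticAt.inv ?_ ?_)
    · exact AnalyticAt.fun_comp (f := φ.symm) (g := fun z => (fderiv ℂ g z).det) (by rwa [hφ0]) hφ
    · rwa [hφ0]
  have hU : ∀ᶠ w in 𝓝 0, φ.symm w ∈ Metric.ball a r :=
    hφ.continuousAt.eventually (by rw [hφ0]; exact Metric.ball_mem_nhds a hr.1)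
  obtain ⟨ρ, hρ, hb⟩ := Metric.eventually_nhds_iff_ball.1
    ((hF.and hU).and (φ.open_target.mem_nhds h0t))
  have hερ : ∀ᶠ ε : Fin 2 → ℝ in 𝓝[{ε : Fin 2 → ℝ | ∀ i, 0 < ε i}] 0, ε ∈ Metric.ball 0 ρ :=
    mem_nhdsWithin_of_mem_nhds (Metric.ball_mem_nhds _ hρ)
  filter_upwards [hερ, self_mem_nhdsWithin] with ε hε hpos
  have hε' : ∀ i, ε i < ρ := fun i =>
    (le_abs_self _).trans_lt ((norm_le_pi_norm ε i).trans_lt (mem_ball_zero_iff.1 hε))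
  have hc := torusIntegral_cauchy (F := fun w => ((fderiv ℂ g (φ.symm w)).det)⁻¹)
    (fun w hw => (hb w hw).1.1.differentiableAt.differentiableWithinAt) hpos hε'
  have : cycleIntegral g (Metric.ball a r) ε =
      torusIntegral (fun w => ((fderiv ℂ g (φ.symm w)).det)⁻¹ * (w 0 * w 1)⁻¹) 0 ε := by
    unfold cycleIntegral torusIntegral
    congr 1; ext θ; congr 1
    set w := torusMap (0 : Plane) ε θ with hw
    have hwb : w ∈ Metric.ball (0 : Plane) ρ := by
      rw [mem_ball_zero_iff, pi_norm_lt_iff hρ]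
      intro i
      simpa [hw, torusMap, Complex.norm_exp, abs_of_pos (hpos i)] using hε' i
    obtain ⟨⟨-, h2⟩, h3⟩ := hb w hwb
    have hset : {z | z ∈ Metric.ball a r ∧ g z = w} = {φ.symm w} := by
      ext z
      simp only [Set.mem_ofPred_eq, Set.mem_singleton_iff, ← hφg]
      constructor
      · rintro ⟨hz, hzw⟩
        rw [← hzw]
        exact (φ.left_inv (hRs (Metric.ball_subset_ball hr.2.le hz))).symm
      · rintro rfl
        exact ⟨h2, φ.right_inv h3⟩
    beta_reduce
    rw [hset, finsum_mem_singleton]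
  rw [this, hc, hφ0, inv_mul_cancel_left₀]
  simp [Real.pi_ne_zero]

end

/-! ### Linear algebra of the derivative at a fixed point -/

section

/-- The eigenvalues of `A` are `l` and `A.det / l`. -/
theorem det_id_sub (A : Plane →L[ℂ] Plane) {w : Plane} (hw : w ≠ 0) {l : ℂ} (hl : l ≠ 0)
    (hA : A w = l • w) :
    (ContinuousLinearMap.id ℂ Plane - A).det = (1 - l) * (1 - A.det / l) := by
  have hdec : A w = w 0 • A (Pi.single 0 1) + w 1 • A (Pi.single 1 1) := by
    have : w = w 0 • (Pi.single 0 1 : Plane) + w 1 • (Pi.single 1 1 : Plane) := by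
      ext i; fin_cases i <;> simp
    conv_lhs => rw [this]
    simp only [map_add, map_smul]
  rw [hA] at hdec
  have h0 := congrFun hdec 0
  have h1 := congrFun hdec 1
  simp only [Pi.smul_apply, Pi.add_apply, smul_eq_mul] at h0 h1
  rw [det_eq_sub, det_eq_sub]
  simp only [sub_apply, ContinuousLinearMap.id_apply, Pi.sub_apply,
    Pi.single_eq_same]
  have e01 : (Pi.single 0 1 : Plane) 1 = 0 := rfl
  have e10 : (Pi.single 1 1 : Plane) 0 = 0 := rfl
  rw [e01, e10]
  generalize A (Pi.single 0 1) 0 = a at *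
  generalize A (Pi.single 0 1) 1 = c at *
  generalize A (Pi.single 1 1) 0 = b at *
  generalize A (Pi.single 1 1) 1 = d at *
  -- The characteristic equation at `l`.
  have hchar : (a - l) * (d - l) - b * c = 0 := by
    have hne : w 0 ≠ 0 ∨ w 1 ≠ 0 := by
      by_contra! h
      exact hw (by ext i; fin_cases i; exacts [h.1, h.2])
    rcases hne with h | h <;> refine (mul_eq_zero.1 ?_).resolve_left h
    · linear_combination (l - d) * h0 + b * h1
    · linear_combination (l - a) * h1 + c * h0
  field_simp
  linear_combination hchar

section Form

variable {B : Plane →L[ℂ] Plane →L[ℂ] ℂ} {A : Plane →L[ℂ] Plane} {d : ℂ}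

theorem form_swap (hB : ∀ v, B v v = 0) (v w : Plane) : B v w = -B w v := by
  have := hB (v + w)
  simp only [map_add, add_apply, hB] at this
  linear_combination this

theorem form_eq_det (hB : ∀ v, B v v = 0) (v w : Plane) :
    B v w = (v 0 * w 1 - v 1 * w 0) * B (Pi.single 0 1) (Pi.single 1 1) := by
  have hdec : ∀ w : Plane,
      w = w 0 • (Pi.single 0 1 : Plane) + w 1 • (Pi.single 1 1 : Plane) := by
    intro w; ext i; fin_cases i <;> simp
  rw [hdec v, hdec w]
  simp only [map_add, map_smul, add_apply, smul_apply, hB,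
    form_swap hB (Pi.single 1 1) (Pi.single 0 1)]
  simp
  ring

theorem form_basis_ne_zero (hB : ∀ v, B v v = 0) (h0 : B ≠ 0) :
    B (Pi.single 0 1) (Pi.single 1 1) ≠ 0 := by
  intro h
  refine h0 (ContinuousLinearMap.ext fun v => ContinuousLinearMap.ext fun w => ?_)
  rw [form_eq_det hB, h]
  simp

theorem form_ne_zero (hB : ∀ v, B v v = 0) (h0 : B ≠ 0) {v w : Plane}
    (hvw : LinearIndependent ℂ ![v, w]) : B v w ≠ 0 := by
  rw [form_eq_det hB]
  refine mul_ne_zero (fun h => ?_) (form_basis_ne_zero hB h0)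
  rw [LinearIndependent.pair_iff] at hvw
  have h1 := hvw (w 1) (-v 1) (by
    ext i; fin_cases i <;> simp
    · linear_combination h
    · ring)
  have h2 := hvw (w 0) (-v 0) (by
    ext i; fin_cases i <;> simp
    · ring
    · linear_combination -h)
  have hv : v = 0 := by
    ext i; fin_cases i
    exacts [neg_eq_zero.1 h2.2, neg_eq_zero.1 h1.2]
  have := hvw 1 0 (by simp [hv])
  exact one_ne_zero this.1

theorem det_eq_of_form (hB : ∀ v, B v v = 0) (h0 : B ≠ 0)
    (hA : ∀ v w, B (A v) (A w) = d * B v w) : A.det = d := by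
  have h := hA (Pi.single 0 1) (Pi.single 1 1)
  rw [form_eq_det hB] at h
  have := mul_right_cancel₀ (form_basis_ne_zero hB h0) h
  rw [det_eq_sub, ← this]
  ring

theorem eigenvalue_mul_of_form (hB : ∀ v, B v v = 0) (h0 : B ≠ 0)
    (hA : ∀ v w, B (A v) (A w) = d * B v w) {v w : Plane}
    (hvw : LinearIndependent ℂ ![v, w]) {a b : ℂ} (hv : A v = a • v) (hw : A w = b • w) :
    a * b = d := by
  have h := hA v w
  rw [hv, hw] at h
  simp only [map_smul, smul_apply, smul_eq_mul] at h
  refine mul_right_cancel₀ (form_ne_zero hB h0 hvw) ?_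
  linear_combination h

theorem swap_mul_of_form (hB : ∀ v, B v v = 0) (h0 : B ≠ 0)
    (hA : ∀ v w, B (A v) (A w) = d * B v w) {v w : Plane}
    (hvw : LinearIndependent ℂ ![v, w]) {a b : ℂ} (hv : A v = a • w) (hw : A w = b • v) :
    a * b = -d := by
  have h := hA v w
  rw [hv, hw] at h
  simp only [map_smul, smul_apply, smul_eq_mul, form_swap hB w v] at h
  refine mul_right_cancel₀ (form_ne_zero hB h0 hvw) ?_
  linear_combination -h

/-- Exchanging the two lines forces `A ^ 2 = a * b = -d`, so the eigenvalues are `±l` with `l ^ 2 =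
-d`, and `(1 - l) * (1 + l) = 1 + d`. -/
theorem det_id_sub_of_swap (hB : ∀ v, B v v = 0) (h0 : B ≠ 0)
    (hA : ∀ v w, B (A v) (A w) = d * B v w) (hd : d ≠ 0) {v w : Plane}
    (hvw : LinearIndependent ℂ ![v, w]) {a b : ℂ} (hv : A v = a • w) (hw : A w = b • v) :
    (ContinuousLinearMap.id ℂ Plane - A).det = 1 + d := by
  have hab := swap_mul_of_form hB h0 hA hvw hv hw
  obtain ⟨l, hl⟩ := IsSquare.exists_sq (-d) (IsAlgClosed.exists_eq_mul_self (-d))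
  have hl0 : l ≠ 0 := by rintro rfl; simp at hl; exact hd hl
  -- This vector is an eigenvector for `l`, because `a * b = l ^ 2`.
  have hne : l • v + a • w ≠ 0 := fun h =>
    hl0 (LinearIndependent.pair_iff.1 hvw _ _ h).1
  rw [det_id_sub A hne hl0, det_eq_of_form hB h0 hA]
  · field_simp
    linear_combination hl
  · rw [map_add, map_smul, map_smul, hv, hw, smul_smul, smul_smul, smul_add, smul_smul, smul_smul,
      hab, hl, sq, add_comm]

end Form

variable {X : Type*} [TopologicalSpace X] [ChartedSpace Plane X]

/-- The derivative of a self-map of a surface, as an endomorphism of the model plane. -/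
def tangentMapAt (f : X → X) (p : X) : Plane →L[ℂ] Plane :=
  mfderiv 𝓘(ℂ, Plane) 𝓘(ℂ, Plane) f p

section Displacement

variable {f : X → X} {p : X}

theorem displacement_self (hfp : f p = p) :
    displacement f p (extChartAt 𝓘(ℂ, Plane) p p) = 0 := by
  simp [displacement, writtenInExtChartAt, hfp]

theorem analyticAt_displacement (hf : ContMDiffAt 𝓘(ℂ, Plane) 𝓘(ℂ, Plane) ω f p) :
    AnalyticAt ℂ (displacement f p) (extChartAt 𝓘(ℂ, Plane) p p) := by
  have h := (contMDiffAt_iff.1 hf).2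
  simp only [modelWithCornersSelf_coe, Set.range_id, contDiffWithinAt_univ] at h
  exact analyticAt_id.sub h.analyticAt

theorem fderiv_displacement (hf : ContMDiffAt 𝓘(ℂ, Plane) 𝓘(ℂ, Plane) ω f p) :
    fderiv ℂ (displacement f p) (extChartAt 𝓘(ℂ, Plane) p p) =
      ContinuousLinearMap.id ℂ Plane - tangentMapAt f p := by
  have h := (hf.mdifferentiableAt (by simp)).hasMFDerivAt.2
  simp only [modelWithCornersSelf_coe, Set.range_id] at h
  exact ((hasFDerivAt_id _).sub (hasFDerivWithinAt_univ.1 h)).fderiv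

theorem mu_eq_one (hf : ContMDiffAt 𝓘(ℂ, Plane) 𝓘(ℂ, Plane) ω f p) (hfp : f p = p)
    (hdet : (ContinuousLinearMap.id ℂ Plane - tangentMapAt f p).det ≠ 0) :
    mu f p = 1 :=
  multiplicity_eq_one (analyticAt_displacement hf) (displacement_self hfp)
    (by rwa [fderiv_displacement hf])

theorem nu_eq_inv_det (hf : ContMDiffAt 𝓘(ℂ, Plane) 𝓘(ℂ, Plane) ω f p) (hfp : f p = p)
    (hdet : (ContinuousLinearMap.id ℂ Plane - tangentMapAt f p).det ≠ 0) :
    nu f p = ((ContinuousLinearMap.id ℂ Plane - tangentMapAt f p).det)⁻¹ := by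
  rw [nu, residue_eq_inv_det (analyticAt_displacement hf) (displacement_self hfp),
    fderiv_displacement hf]
  rwa [fderiv_displacement hf]

/-- By the inverse function theorem the displacement is injective near `p`, so `p` is its only
nearby zero. -/
theorem eventually_ne_of_det_ne_zero (hf : ContMDiffAt 𝓘(ℂ, Plane) 𝓘(ℂ, Plane) ω f p) (hfp : f p = p)
    (hdet : (ContinuousLinearMap.id ℂ Plane - tangentMapAt f p).det ≠ 0) :
    ∀ᶠ q in 𝓝[≠] p, f q ≠ q := by
  obtain ⟨φ, hφ, hp, -⟩ := exists_localInverse (analyticAt_displacement hf)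
    (displacement_self hfp) (by rwa [fderiv_displacement hf])
  have hc : ∀ᶠ q in 𝓝 p, extChartAt 𝓘(ℂ, Plane) p q ∈ φ.source :=
    (continuousAt_extChartAt p).eventually (φ.open_source.mem_nhds hp)
  rw [eventually_nhdsWithin_iff]
  filter_upwards [hc, extChartAt_source_mem_nhds (I := 𝓘(ℂ, Plane)) p] with q hq hqs hqp hfq
  refine hqp ((extChartAt 𝓘(ℂ, Plane) p).injOn hqs (mem_extChartAt_source p) ?_)
  refine φ.injOn hq hp ?_
  rw [hφ, displacement_self hfp]
  simp only [displacement, writtenInExtChartAt, hfp, Function.comp_apply,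
    (extChartAt 𝓘(ℂ, Plane) p).left_inv hqs, hfq, sub_self]

end Displacement

end

/-! ### Rational curves in a surface and the maps between them -/

section

variable {X : Type*} [TopologicalSpace X] [ChartedSpace Plane X]

/-- The derivative of an arc in a surface. -/
def arcDeriv (γ : ℂ → X) (s : ℂ) : ℂ →L[ℂ] Plane :=
  mfderiv 𝓘(ℂ) 𝓘(ℂ, Plane) γ s

/-- The velocity of a holomorphic arc. -/
def velocity (γ : ℂ → X) (s : ℂ) : Plane :=
  (mfderiv 𝓘(ℂ) 𝓘(ℂ, Plane) γ s (1 : ℂ) : Plane)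

theorem velocity_congr {γ γ' : ℂ → X} {s : ℂ} (h : γ =ᶠ[𝓝 s] γ') :
    velocity γ s = velocity γ' s := by
  unfold velocity
  rw [h.mfderiv_eq]
  rfl

theorem velocity_comp_right {γ : ℂ → X} {φ : ℂ → ℂ} {s c : ℂ}
    (hγ : MDifferentiableAt 𝓘(ℂ) 𝓘(ℂ, Plane) γ (φ s)) (hφ : HasDerivAt φ c s) :
    velocity (fun t => γ (φ t)) s = c • velocity γ (φ s) := by
  have h := (hγ.hasMFDerivAt.comp s hφ.hasFDerivAt.hasMFDerivAt).mfderiv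
  have h' : velocity (fun t => γ (φ t)) s =
      mfderiv 𝓘(ℂ) 𝓘(ℂ, Plane) γ (φ s) (c : ℂ) := by
    unfold velocity
    change (mfderiv 𝓘(ℂ) 𝓘(ℂ, Plane) (γ ∘ φ) s) (1 : ℂ) = _
    rw [h]
    change (mfderiv 𝓘(ℂ) 𝓘(ℂ, Plane) γ (φ s)) ((1 : ℂ) • c) = _
    rw [one_smul]
  rw [h']
  have : (c : ℂ) = c • (1 : ℂ) := by simp
  conv_lhs => rw [this]
  exact map_smul (mfderiv 𝓘(ℂ) 𝓘(ℂ, Plane) γ (φ s)) c (1 : ℂ)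

theorem velocity_comp_left {γ : ℂ → X} {f : X → X} {s : ℂ}
    (hf : MDifferentiableAt 𝓘(ℂ, Plane) 𝓘(ℂ, Plane) f (γ s))
    (hγ : MDifferentiableAt 𝓘(ℂ) 𝓘(ℂ, Plane) γ s) :
    velocity (fun t => f (γ t)) s = tangentMapAt f (γ s) (velocity γ s) := by
  have h := (hf.hasMFDerivAt.comp s hγ.hasMFDerivAt).mfderiv
  unfold velocity tangentMapAt
  change (mfderiv 𝓘(ℂ) 𝓘(ℂ, Plane) (f ∘ γ) s) (1 : ℂ) = _
  rw [h]
  rfl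

theorem hasDerivAt_extChartAt_comp {γ : ℂ → X} {s : ℂ}
    (hγ : MDifferentiableAt 𝓘(ℂ) 𝓘(ℂ, Plane) γ s) :
    HasDerivAt (fun t => extChartAt 𝓘(ℂ, Plane) (γ s) (γ t)) (velocity γ s) s := by
  have h := hγ.hasMFDerivAt.2
  simp only [modelWithCornersSelf_coe, Set.range_id] at h
  have h' : HasFDerivAt (fun t => extChartAt 𝓘(ℂ, Plane) (γ s) (γ t)) (arcDeriv γ s) s :=
    hasFDerivWithinAt_univ.1 h
  exact h'.hasDerivAt

theorem analyticAt_extChartAt_comp {γ : ℂ → X} {s : ℂ}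
    (hγ : ContMDiffAt 𝓘(ℂ) 𝓘(ℂ, Plane) ω γ s) :
    AnalyticAt ℂ (fun t => extChartAt 𝓘(ℂ, Plane) (γ s) (γ t)) s := by
  have h := (contMDiffAt_iff.1 hγ).2
  simp only [modelWithCornersSelf_coe, Set.range_id, contDiffWithinAt_univ] at h
  exact h.analyticAt

/-- `u` and `v` are the two affine charts of an embedding of `ℙ¹` with image `C`. -/
structure IsParam (C : Set X) (u v : ℂ → X) : Prop where
  left : ContMDiff 𝓘(ℂ) 𝓘(ℂ, Plane) ω u
  right : ContMDiff 𝓘(ℂ) 𝓘(ℂ, Plane) ω v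
  glue : ∀ s : ℂ, s ≠ 0 → v s = u s⁻¹
  inj : Function.Injective u
  not_mem : v 0 ∉ Set.range u
  velocity_left : ∀ s : ℂ, velocity u s ≠ 0
  velocity_right : velocity v 0 ≠ 0
  eq : C = insert (v 0) (Set.range u)

theorem mfderiv_ne_zero_iff {γ : ℂ → X} {s : ℂ} :
    mfderiv 𝓘(ℂ) 𝓘(ℂ, Plane) γ s ≠ 0 ↔ velocity γ s ≠ 0 := by
  refine not_congr ⟨fun h => by unfold velocity; rw [h]; rfl, fun h => ?_⟩
  exact ContinuousLinearMap.ext_ring (f := arcDeriv γ s) (g := 0) h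

theorem IsSmoothRationalCurve.exists_param {C : Set X} (h : IsSmoothRationalCurve C) :
    ∃ u v, IsParam C u v := by
  obtain ⟨u, v, h1, h2, h3, h4, h5, h6, h7, h8⟩ := h
  exact ⟨u, v, h1, h2, h3, h4, h5, fun s => mfderiv_ne_zero_iff.1 (h6 s),
    mfderiv_ne_zero_iff.1 h7, h8⟩

namespace IsParam

variable {C C' : Set X} {u v u' v' : ℂ → X}

theorem mdifferentiable_left (h : IsParam C u v) (s : ℂ) :
    MDifferentiableAt 𝓘(ℂ) 𝓘(ℂ, Plane) u s := (h.left s).mdifferentiableAt (by simp)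

theorem mdifferentiable_right (h : IsParam C u v) (s : ℂ) :
    MDifferentiableAt 𝓘(ℂ) 𝓘(ℂ, Plane) v s := (h.right s).mdifferentiableAt (by simp)

theorem left_mem (h : IsParam C u v) (s : ℂ) : u s ∈ C := by
  rw [h.eq]; exact Or.inr ⟨s, rfl⟩

theorem right_mem (h : IsParam C u v) (s : ℂ) : v s ∈ C := by
  rcases eq_or_ne s 0 with rfl | hs
  · rw [h.eq]; exact Or.inl rfl
  · rw [h.glue s hs]; exact h.left_mem _

theorem right_zero_ne (h : IsParam C u v) (s : ℂ) : v 0 ≠ u s := fun hs => h.not_mem ⟨s, hs.symm⟩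

theorem eq_left_of_mem (h : IsParam C u v) {p : X} (hp : p ∈ C) (hne : p ≠ v 0) :
    ∃ s, p = u s := by
  rw [h.eq] at hp
  obtain ⟨s, hs⟩ := hp.resolve_left hne
  exact ⟨s, hs.symm⟩

theorem swap (h : IsParam C u v) : IsParam C v u where
  left := h.right
  right := h.left
  glue s hs := by rw [h.glue _ (inv_ne_zero hs), inv_inv]
  inj s t hst := by
    rcases eq_or_ne s 0 with rfl | hs <;> rcases eq_or_ne t 0 with rfl | ht
    · rfl
    · rw [h.glue t ht] at hst; exact absurd hst (h.right_zero_ne _)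
    · rw [h.glue s hs] at hst; exact absurd hst.symm (h.right_zero_ne _)
    · rw [h.glue s hs, h.glue t ht] at hst; exact inv_injective (h.inj hst)
  not_mem := by
    rintro ⟨s, hs⟩
    rcases eq_or_ne s 0 with rfl | h0
    · exact h.right_zero_ne _ hs
    · rw [h.glue s h0] at hs; exact inv_ne_zero h0 (h.inj hs)
  velocity_left s := by
    rcases eq_or_ne s 0 with rfl | h0
    · exact h.velocity_right
    · have : v =ᶠ[𝓝 s] fun t => u t⁻¹ := by
        filter_upwards [isOpen_ne.mem_nhds h0] with t ht using h.glue t ht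
      rw [velocity_congr this, velocity_comp_right (h.mdifferentiable_left _) (hasDerivAt_inv h0)]
      exact smul_ne_zero (by simpa using h0) (h.velocity_left _)
  velocity_right := h.velocity_left 0
  eq := by
    refine Set.Subset.antisymm (fun p hp => ?_) ?_
    · rw [h.eq] at hp
      rcases hp with rfl | ⟨s, rfl⟩
      · exact Or.inr ⟨0, rfl⟩
      · rcases eq_or_ne s 0 with rfl | h0
        · exact Or.inl rfl
        · exact Or.inr ⟨s⁻¹, by rw [h.glue _ (inv_ne_zero h0), inv_inv]⟩
    · rintro p (rfl | ⟨s, rfl⟩)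
      exacts [h.left_mem 0, h.right_mem s]

/-- Together with `swap`, translations make it possible to place any two distinct points of the
curve at `0` and `∞`. -/
theorem translate (h : IsParam C u v) (a : ℂ) :
    ∃ v', IsParam C (fun s => u (s + a)) v' ∧ v' 0 = v 0 := by
  classical
  let v' : ℂ → X := fun s => if s = 0 then v 0 else u (s⁻¹ + a)
  -- The translation `z ↦ z + a`, read in the coordinate `1 / z` at infinity.
  have hloc : v' =ᶠ[𝓝 0] fun s => v (s / (1 + a * s)) := by
    have : ∀ᶠ s : ℂ in 𝓝 0, 1 + a * s ≠ 0 := by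
      refine ContinuousAt.eventually_ne (by fun_prop) (by simp)
    filter_upwards [this] with s hs
    rcases eq_or_ne s 0 with rfl | h0
    · simp [v']
    · rw [h.glue _ (div_ne_zero h0 hs)]
      simp only [v', if_neg h0]
      congr 1
      field_simp
  have hder : HasDerivAt (fun s : ℂ => s / (1 + a * s)) 1 0 := by
    have := (hasDerivAt_id (0 : ℂ)).div (c := id) (d := fun s => 1 + a * s)
      (((hasDerivAt_id (0 : ℂ)).const_mul a).const_add 1) (by simp)
    simp only [id, mul_one, mul_zero, add_zero, zero_mul, sub_zero, one_pow, div_one] at this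
    exact this
  have hsm : ContDiffAt ℂ ω (fun s : ℂ => s / (1 + a * s)) 0 :=
    contDiffAt_id.div (contDiffAt_const.add (contDiffAt_const.mul contDiffAt_id)) (by simp)
  refine ⟨v', ⟨?_, ?_, ?_, ?_, ?_, ?_, ?_, ?_⟩, by simp [v']⟩
  · exact h.left.comp (contDiff_id.add contDiff_const).contMDiff
  · intro s
    rcases eq_or_ne s 0 with rfl | h0
    · refine ContMDiffAt.congr_of_eventuallyEq ?_ hloc
      exact (h.right _).comp (0 : ℂ) hsm.contMDiffAt
    · have : v' =ᶠ[𝓝 s] fun t => u (t⁻¹ + a) := by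
        filter_upwards [isOpen_ne.mem_nhds h0] with t ht using if_neg ht
      refine ContMDiffAt.congr_of_eventuallyEq ?_ this
      exact (h.left _).comp s
        ((contDiffAt_inv ℂ h0).add contDiffAt_const).contMDiffAt
  · intro s hs
    simp [v', hs]
  · intro s t hst
    simpa using h.inj hst
  · rintro ⟨s, hs⟩
    simp only [v', if_pos rfl] at hs
    exact h.right_zero_ne _ hs.symm
  · intro s
    rw [velocity_comp_right (φ := fun s => s + a) (h.mdifferentiable_left _)
      ((hasDerivAt_id s).add_const a), one_smul]
    exact h.velocity_left _
  · rw [velocity_congr hloc, velocity_comp_right (φ := fun s : ℂ => s / (1 + a * s))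
      (h.mdifferentiable_right _) hder, one_smul]
    simpa using h.velocity_right
  · rw [h.eq]
    congr 1
    · simp [v']
    · ext p
      constructor
      · rintro ⟨s, rfl⟩; exact ⟨s - a, by simp⟩
      · rintro ⟨s, rfl⟩; exact ⟨s + a, rfl⟩

theorem exists_right_eq (h : IsParam C u v) {q : X} (hq : q ∈ C) :
    ∃ u' v', IsParam C u' v' ∧ v' 0 = q := by
  by_cases hqv : q = v 0
  · exact ⟨u, v, h, hqv.symm⟩
  · obtain ⟨a, rfl⟩ := h.eq_left_of_mem hq hqv
    obtain ⟨v', h', -⟩ := h.translate a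
    exact ⟨_, _, h'.swap, by simp⟩

theorem exists_left_right_eq (h : IsParam C u v) {p q : X} (hp : p ∈ C) (hq : q ∈ C)
    (hpq : p ≠ q) : ∃ u' v', IsParam C u' v' ∧ u' 0 = p ∧ v' 0 = q := by
  obtain ⟨u₁, v₁, h₁, rfl⟩ := h.exists_right_eq hq
  obtain ⟨a, rfl⟩ := h₁.eq_left_of_mem hp hpq
  obtain ⟨v', h', h0⟩ := h₁.translate a
  exact ⟨_, _, h', by simp, h0⟩

/-- Compactness of the curve away from a disc shows that points of `C` near `u t` in `X` have
parameters near `t`. It is proved by covering this set with compact pieces of the two charts. -/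
theorem isCompact_diff (h : IsParam C u v) (t : ℂ) {r : ℝ} (hr : 0 < r) :
    IsCompact (C \ u '' Metric.ball t r) := by
  set R : ℝ := ‖t‖ + r + 1 with hR
  have hRpos : 0 < R := by positivity
  have : C \ u '' Metric.ball t r =
      u '' (Metric.closedBall 0 R \ Metric.ball t r) ∪ v '' Metric.closedBall 0 R⁻¹ := by
    ext p
    constructor
    · rintro ⟨hp, hpn⟩
      by_cases hpv : p = v 0
      · exact Or.inr ⟨0, by simp [hRpos.le], hpv.symm⟩
      · obtain ⟨s, rfl⟩ := h.eq_left_of_mem hp hpv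
        by_cases hs : ‖s‖ ≤ R
        · exact Or.inl ⟨s, ⟨by simpa using hs, fun hs' => hpn ⟨s, hs', rfl⟩⟩, rfl⟩
        · push Not at hs
          have hs0 : s ≠ 0 := norm_pos_iff.1 (hRpos.trans hs)
          refine Or.inr ⟨s⁻¹, ?_, by rw [h.glue _ (inv_ne_zero hs0), inv_inv]⟩
          rw [mem_closedBall_zero_iff, norm_inv]
          exact inv_anti₀ hRpos hs.le
    · rintro (⟨s, ⟨-, hs⟩, rfl⟩ | ⟨s, hs, rfl⟩)
      · refine ⟨h.left_mem s, ?_⟩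
        rintro ⟨s', hs', he⟩
        exact hs (h.inj he ▸ hs')
      · refine ⟨h.right_mem s, ?_⟩
        rintro ⟨s', hs', he⟩
        rcases eq_or_ne s 0 with rfl | h0
        · exact h.right_zero_ne _ he.symm
        · rw [h.glue s h0] at he
          have := h.inj he
          subst this
          rw [mem_closedBall_zero_iff] at hs
          have h1 : ‖s⁻¹‖ < R := by
            have h2 : ‖s⁻¹‖ ≤ ‖s⁻¹ - t‖ + ‖t‖ := norm_le_norm_sub_add _ _
            rw [mem_ball_iff_norm] at hs'
            linarith
          rw [norm_inv] at h1
          have h3 := inv_anti₀ (norm_pos_iff.2 h0) hs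
          rw [inv_inv] at h3
          linarith
  rw [this]
  exact (((isCompact_closedBall _ _).diff Metric.isOpen_ball).image h.left.continuous).union
    ((isCompact_closedBall _ _).image h.right.continuous)

/-- An arc inside an embedded curve is holomorphic in the parameter of the curve: one coordinate of
`u` has nonzero derivative at `t` and can be inverted there. -/
theorem exists_lift [T2Space X] (h : IsParam C u v) {γ : ℂ → X} {s t : ℂ}
    (hγ : MDifferentiableAt 𝓘(ℂ) 𝓘(ℂ, Plane) γ s) (hC : ∀ᶠ x in 𝓝 s, γ x ∈ C)
    (hst : γ s = u t) :
    ∃ φ : ℂ → ℂ, φ s = t ∧ DifferentiableAt ℂ φ s ∧ ∀ᶠ x in 𝓝 s, γ x = u (φ x) := by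
  have han := analyticAt_extChartAt_comp (h.left t)
  have hder := hasDerivAt_extChartAt_comp (h.mdifferentiable_left t)
  have hγd := hasDerivAt_extChartAt_comp hγ
  rw [hst] at hγd
  obtain ⟨i, hi⟩ : ∃ i, velocity u t i ≠ 0 := Function.ne_iff.1 (h.velocity_left t)
  have hani : AnalyticAt ℂ (fun x => extChartAt 𝓘(ℂ, Plane) (u t) (u x) i) t :=
    ((ContinuousLinearMap.proj (R := ℂ) (φ := fun _ : Fin 2 => ℂ) i).analyticAt _).comp han
  have hderi : deriv (fun x => extChartAt 𝓘(ℂ, Plane) (u t) (u x) i) t ≠ 0 := by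
    rwa [(hasDerivAt_pi.1 hder i).deriv]
  have hinv := hani.analyticAt_localInverse hderi
  have hleft := HasStrictDerivAt.eventually_left_inverse hani.hasStrictDerivAt hderi
  set ρ := hani.hasStrictDerivAt.localInverse _ _ _ hderi
  obtain ⟨r, hr, hball⟩ := Metric.eventually_nhds_iff_ball.1 hleft
  -- The part of `C` outside the disc is closed and misses `γ s`, so the arc stays in the disc where
  -- the local inverse is valid.
  have hev : ∀ᶠ x in 𝓝 s, γ x ∈ u '' Metric.ball t r := by
    have hcl : (C \ u '' Metric.ball t r)ᶜ ∈ 𝓝 (γ s) := by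
      refine (h.isCompact_diff t hr).isClosed.isOpen_compl.mem_nhds ?_
      rw [hst]
      exact fun hn => hn.2 ⟨t, Metric.mem_ball_self hr, rfl⟩
    filter_upwards [hγ.continuousAt.eventually hcl, hC] with x hx hxC
    by_contra hn
    exact hx ⟨hxC, hn⟩
  refine ⟨fun x => ρ (extChartAt 𝓘(ℂ, Plane) (u t) (γ x) i), ?_, ?_, ?_⟩
  · change ρ (extChartAt 𝓘(ℂ, Plane) (u t) (γ s) i) = t
    rw [hst]
    exact hball t (Metric.mem_ball_self hr)
  · refine DifferentiableAt.comp (g := ρ) s ?_ (hasDerivAt_pi.1 hγd i).differentiableAt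
    rw [hst]
    exact hinv.differentiableAt
  · filter_upwards [hev] with x hx
    obtain ⟨y, hy, hyx⟩ := hx
    rw [← hyx, hball y hy]

/-- In the affine coordinates `f` becomes an entire function `φ`, and near infinity `φ (1 / t) = 1 /
ψ t` with `ψ` having a simple zero at `0`. Hence `φ` grows at most linearly and is affine; its slope
is the inverse of the derivative at infinity. -/
theorem exists_affine [T2Space X] (h : IsParam C u v) (h' : IsParam C' u' v') {f : X → X}
    (hf : ∀ p ∈ C, MDifferentiableAt 𝓘(ℂ, Plane) 𝓘(ℂ, Plane) f p) (hinj : Set.InjOn f C)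
    (hmaps : Set.MapsTo f C C') (h0 : f (v 0) = v' 0)
    (hd : tangentMapAt f (v 0) (velocity v 0) ≠ 0) :
    ∃ a b : ℂ, a ≠ 0 ∧ (∀ s, f (u s) = u' (a * s + b)) ∧
      tangentMapAt f (v 0) (velocity v 0) = a⁻¹ • velocity v' 0 := by
  have hex : ∀ s, ∃ t, f (u s) = u' t := fun s => by
    refine h'.eq_left_of_mem (hmaps (h.left_mem s)) fun hs => ?_
    rw [← h0] at hs
    exact h.right_zero_ne s (hinj (h.left_mem s) (h.right_mem 0) hs).symm
  choose φ hφ using hex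
  have hφd : Differentiable ℂ φ := fun s => by
    obtain ⟨φ', -, hd', he⟩ := h'.exists_lift (γ := fun x => f (u x)) (s := s) (t := φ s)
      ((hf _ (h.left_mem s)).comp s (h.mdifferentiable_left s))
      (Filter.Eventually.of_forall fun x => hmaps (h.left_mem x)) (hφ s)
    refine hd'.congr_of_eventuallyEq ?_
    filter_upwards [he] with x hx
    exact h'.inj ((hφ x).symm.trans hx)
  obtain ⟨ψ, hψ0, hψd, hψ⟩ := h'.swap.exists_lift (γ := fun x => f (v x)) (s := 0) (t := 0)
    ((hf _ (h.right_mem 0)).comp (0 : ℂ) (h.mdifferentiable_right 0))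
    (Filter.Eventually.of_forall fun x => hmaps (h.right_mem x)) h0
  have hvel : tangentMapAt f (v 0) (velocity v 0) = deriv ψ 0 • velocity v' 0 := by
    rw [← velocity_comp_left (hf _ (h.right_mem 0)) (h.mdifferentiable_right 0),
      velocity_congr hψ, velocity_comp_right (h'.mdifferentiable_right _) hψd.hasDerivAt, hψ0]
  set e := deriv ψ 0 with he
  have he0 : e ≠ 0 := by
    intro h1; rw [hvel, h1, zero_smul] at hd; exact hd rfl
  have hinvψ : ∀ᶠ t in 𝓝[≠] (0 : ℂ), φ t⁻¹ = (ψ t)⁻¹ := by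
    filter_upwards [nhdsWithin_le_nhds hψ, self_mem_nhdsWithin] with t ht ht0
    have ht0' : t ≠ 0 := ht0
    have hψt : ψ t ≠ 0 := by
      intro hz
      rw [hz, ← h0] at ht
      exact ht0' (h.swap.inj (hinj (h.right_mem t) (h.right_mem 0) ht))
    rw [h.glue t ht0', hφ, h'.glue _ hψt] at ht
    exact h'.inj ht
  -- With `z = 1 / t`, the slope `(φ z - φ 0) / z` is `t / ψ t - φ 0 * t`.
  have hlim : Filter.Tendsto (dslope φ 0) (Filter.cocompact ℂ) (𝓝 e⁻¹) := by
    have hinv : Filter.Tendsto (fun z : ℂ => z⁻¹) (Filter.cocompact ℂ) (𝓝[≠] 0) := by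
      rw [← Metric.cobounded_eq_cocompact]
      exact Filter.tendsto_inv₀_cobounded'
    have hslope : Filter.Tendsto (fun t => t * (ψ t)⁻¹ - φ 0 * t) (𝓝[≠] 0) (𝓝 (e⁻¹ - φ 0 * 0)) := by
      refine Filter.Tendsto.sub ?_ (Filter.Tendsto.mono_left
        (Continuous.tendsto (by fun_prop) 0) nhdsWithin_le_nhds)
      have := (hasDerivAt_iff_tendsto_slope.1 hψd.hasDerivAt).inv₀ he0
      refine this.congr fun t => ?_
      simp [slope_def_field, hψ0]
      rw [div_eq_mul_inv]
    rw [mul_zero, sub_zero] at hslope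
    refine (hslope.comp hinv).congr' ?_
    filter_upwards [hinv.eventually hinvψ, hinv.eventually self_mem_nhdsWithin] with z hz hz0
    have hz0' : z ≠ 0 := by simpa using hz0
    rw [dslope_of_ne _ hz0', slope_def_field]
    simp only [Function.comp_apply]
    rw [← hz, inv_inv, sub_zero]
    field_simp
  have hds : Differentiable ℂ (dslope φ 0) := by
    rw [← differentiableOn_univ, Complex.differentiableOn_dslope Filter.univ_mem]
    exact hφd.differentiableOn
  -- Liouville: an entire function with a finite limit at infinity is constant.
  have hconst : ∀ z, dslope φ 0 z = e⁻¹ := fun z =>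
    hds.apply_eq_of_tendsto_cocompact z hlim
  refine ⟨e⁻¹, φ 0, inv_ne_zero he0, fun s => ?_, by rw [hvel, inv_inv]⟩
  rw [hφ]
  congr 1
  have := sub_smul_dslope φ 0 s
  rw [hconst, sub_zero, smul_eq_mul] at this
  linear_combination -this

end IsParam

end

/-! ### Tangent lines, self-maps and their multipliers -/

section

variable {X : Type*} [TopologicalSpace X] [ChartedSpace Plane X]

section TangentVectors

variable {C C' : Set X} {p : X}

theorem IsParam.velocity_mem {u v : ℂ → X} (h : IsParam C u v) (s : ℂ) :
    velocity u s ∈ tangentVectors C (u s) := by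
  refine ⟨fun t => u (t + s), by simp, ?_, Filter.Eventually.of_forall fun t => h.left_mem _, ?_⟩
  · exact (h.left _).comp (0 : ℂ) (contDiffAt_id.add contDiffAt_const).contMDiffAt
  · change velocity (fun t => u (t + s)) 0 = velocity u s
    rw [velocity_comp_right (φ := fun t => t + s) (h.mdifferentiable_left _)
      ((hasDerivAt_id 0).add_const s), one_smul, zero_add]

theorem IsParam.exists_eq_smul_velocity [T2Space X] {u v : ℂ → X} (h : IsParam C u v) {s : ℂ}
    {w : Plane} (hw : w ∈ tangentVectors C (u s)) : ∃ c : ℂ, w = c • velocity u s := by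
  obtain ⟨γ, h0, hγ, hC, rfl⟩ := hw
  have hγd := hγ.mdifferentiableAt (n := ω) (by simp)
  obtain ⟨φ, hφ0, hφ, he⟩ := h.exists_lift hγd hC h0
  refine ⟨deriv φ 0, ?_⟩
  change velocity γ 0 = _
  rw [velocity_congr he, velocity_comp_right (h.mdifferentiable_left _) hφ.hasDerivAt, hφ0]

theorem smul_mem_tangentVectors {w : Plane} (hw : w ∈ tangentVectors C p) (c : ℂ) :
    c • w ∈ tangentVectors C p := by
  obtain ⟨γ, h0, hγ, hC, rfl⟩ := hw
  have hm : ContinuousAt (fun t : ℂ => c * t) 0 := by fun_prop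
  refine ⟨fun t => γ (c * t), by simp [h0], ?_, ?_, ?_⟩
  · exact ContMDiffAt.comp (0 : ℂ) (g := γ) (f := fun t : ℂ => c * t) (by simpa using hγ)
      (contDiffAt_const.mul contDiffAt_id).contMDiffAt
  · exact hm.eventually (by simpa using hC)
  · change velocity (fun t => γ (c * t)) 0 = c • velocity γ 0
    rw [velocity_comp_right (φ := fun t => c * t) (c := c) ?_ (by
      simpa using (hasDerivAt_id (0 : ℂ)).const_mul c), mul_zero]
    rw [mul_zero]
    exact hγ.mdifferentiableAt (n := ω) (by simp)

theorem tangentMapAt_mem_tangentVectors {f : X → X}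
    (hf : ContMDiffAt 𝓘(ℂ, Plane) 𝓘(ℂ, Plane) ω f p) (hC : Set.MapsTo f C C') {w : Plane}
    (hw : w ∈ tangentVectors C p) : tangentMapAt f p w ∈ tangentVectors C' (f p) := by
  obtain ⟨γ, rfl, hγ, hγC, rfl⟩ := hw
  refine ⟨fun t => f (γ t), rfl, hf.comp (0 : ℂ) hγ, hγC.mono fun t ht => hC ht, ?_⟩
  exact velocity_comp_left (hf.mdifferentiableAt (n := ω) (by simp))
    (hγ.mdifferentiableAt (n := ω) (by simp))

theorem IsSmoothRationalCurve.exists_tangent_ne_zero (hC : IsSmoothRationalCurve C) (hp : p ∈ C) :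
    ∃ w ∈ tangentVectors C p, w ≠ 0 := by
  obtain ⟨u, v, h⟩ := hC.exists_param
  obtain ⟨u, v, h, rfl⟩ := h.exists_right_eq hp
  exact ⟨_, h.swap.velocity_mem 0, h.velocity_right⟩

theorem IsSmoothRationalCurve.exists_eq_smul [T2Space X] (hC : IsSmoothRationalCurve C)
    (hp : p ∈ C) {w w' : Plane} (hw : w ∈ tangentVectors C p) (hw0 : w ≠ 0)
    (hw' : w' ∈ tangentVectors C p) : ∃ c : ℂ, w' = c • w := by
  obtain ⟨u, v, h⟩ := hC.exists_param
  obtain ⟨u, v, h, rfl⟩ := h.exists_right_eq hp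
  obtain ⟨c, rfl⟩ := h.swap.exists_eq_smul_velocity hw
  obtain ⟨c', rfl⟩ := h.swap.exists_eq_smul_velocity hw'
  have hc : c ≠ 0 := by rintro rfl; simp at hw0
  exact ⟨c' / c, by rw [smul_smul, div_mul_cancel₀ _ hc]⟩

theorem linearIndependent_of_transversal
    (h : tangentVectors C p ∩ tangentVectors C' p ⊆ {0}) {w w' : Plane}
    (hw : w ∈ tangentVectors C p) (hw' : w' ∈ tangentVectors C' p) (h0 : w ≠ 0) (h0' : w' ≠ 0) :
    LinearIndependent ℂ ![w, w'] := by
  rw [LinearIndependent.pair_iff' h0]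
  intro c hc
  exact h0' (h ⟨hc ▸ smul_mem_tangentVectors hw c, hw'⟩)

theorem IsSmoothRationalCurve.infinite (hC : IsSmoothRationalCurve C) : C.Infinite := by
  obtain ⟨u, v, h⟩ := hC.exists_param
  exact (Set.infinite_range_of_injective h.inj).mono (by
    rintro _ ⟨s, rfl⟩
    exact h.left_mem s)

theorem IsSmoothRationalCurve.not_isolated (hC : IsSmoothRationalCurve C) {f : X → X}
    (hf : ∀ q ∈ C, f q = q) (hp : p ∈ C) : ¬ ∀ᶠ q in 𝓝[≠] p, f q ≠ q := by
  obtain ⟨u, v, h⟩ := hC.exists_param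
  obtain ⟨u, v, h, rfl⟩ := h.exists_right_eq hp
  intro hev
  have ht : Filter.Tendsto v (𝓝[≠] 0) (𝓝[≠] (v 0)) :=
    h.right.continuous.continuousAt.continuousWithinAt.tendsto_nhdsWithin
      fun t ht hv => ht (h.swap.inj hv)
  obtain ⟨t, ht⟩ := (ht.eventually hev).exists
  exact ht (hf _ (h.right_mem t))

end TangentVectors

/-- A field of nonzero alternating forms. -/
structure IsAreaField (η : X → Plane →L[ℂ] Plane →L[ℂ] ℂ) : Prop where
  alternating : ∀ x v, η x v v = 0
  ne_zero : ∀ x, η x ≠ 0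

/-- `f` is an injective self-map of `S`, holomorphic near `S`, with `f^* η = d η` along `S`. -/
structure IsSelfMap (f : X → X) (S : Set X) (η : X → Plane →L[ℂ] Plane →L[ℂ] ℂ) (d : ℂ) :
    Prop where
  mapsTo : Set.MapsTo f S S
  injOn : Set.InjOn f S
  smooth : ∀ p ∈ S, ContMDiffAt 𝓘(ℂ, Plane) 𝓘(ℂ, Plane) ω f p
  pullback : ∀ p ∈ S, ∀ v w,
    η (f p) (tangentMapAt f p v) (tangentMapAt f p w) = d * η p v w

theorem tangentMapAt_comp {f g : X → X} {p : X}
    (hf : MDifferentiableAt 𝓘(ℂ, Plane) 𝓘(ℂ, Plane) f (g p))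
    (hg : MDifferentiableAt 𝓘(ℂ, Plane) 𝓘(ℂ, Plane) g p) (v : Plane) :
    tangentMapAt (f ∘ g) p v = tangentMapAt f (g p) (tangentMapAt g p v) := by
  have h := (hf.hasMFDerivAt.comp p hg.hasMFDerivAt).mfderiv
  unfold tangentMapAt
  rw [h]
  rfl

theorem tangentMapAt_id (p : X) (v : Plane) : tangentMapAt (id : X → X) p v = v := by
  unfold tangentMapAt
  rw [mfderiv_id]
  rfl

namespace IsSelfMap

variable {f g : X → X} {S C C' : Set X} {η : X → Plane →L[ℂ] Plane →L[ℂ] ℂ} {d e : ℂ} {p q : X}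

theorem mdifferentiableAt (hf : IsSelfMap f S η d) (hp : p ∈ S) :
    MDifferentiableAt 𝓘(ℂ, Plane) 𝓘(ℂ, Plane) f p :=
  (hf.smooth p hp).mdifferentiableAt (by simp)

theorem comp (hf : IsSelfMap f S η d) (hg : IsSelfMap g S η e) :
    IsSelfMap (f ∘ g) S η (d * e) where
  mapsTo := hf.mapsTo.comp hg.mapsTo
  injOn := hf.injOn.comp hg.injOn hg.mapsTo
  smooth _ hp := (hf.smooth _ (hg.mapsTo hp)).comp _ (hg.smooth _ hp)
  pullback p hp v w := by
    rw [tangentMapAt_comp (hf.mdifferentiableAt (hg.mapsTo hp)) (hg.mdifferentiableAt hp),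
      tangentMapAt_comp (hf.mdifferentiableAt (hg.mapsTo hp)) (hg.mdifferentiableAt hp),
      Function.comp_apply, hf.pullback _ (hg.mapsTo hp), hg.pullback p hp, mul_assoc]

theorem iterate (hf : IsSelfMap f S η d) (m : ℕ) : IsSelfMap f^[m] S η (d ^ m) := by
  induction m with
  | zero =>
    refine ⟨Set.mapsTo_id S, Function.injective_id.injOn, fun p _ => contMDiffAt_id,
      fun p _ v w => ?_⟩
    simp only [Function.iterate_zero, tangentMapAt_id, pow_zero, one_mul, id]
  | succ m ih =>
    rw [Function.iterate_succ', pow_succ']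
    exact hf.comp ih

theorem tangentMapAt_ne_zero (hη : IsAreaField η) (hf : IsSelfMap f S η d) (hd : d ≠ 0)
    (hp : p ∈ S) {w : Plane} (hw : w ≠ 0) : tangentMapAt f p w ≠ 0 := by
  intro h
  have h0 : ∀ w', η p w w' = 0 := fun w' => by
    have := hf.pullback p hp w w'
    rw [h] at this
    simpa [hd] using this.symm
  refine hw ?_
  have hb := form_basis_ne_zero (hη.alternating p) (hη.ne_zero p)
  have h1 := h0 (Pi.single 0 1)
  have h2 := h0 (Pi.single 1 1)
  rw [form_eq_det (hη.alternating p)] at h1 h2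
  simp only [mul_eq_zero, hb, or_false] at h1 h2
  ext i; fin_cases i
  · simpa using h2
  · simpa using h1

end IsSelfMap

/-- `l` is the multiplier at the point `p` of the restriction of `f` to the curve `C`. -/
def HasMultiplier (f : X → X) (C : Set X) (p : X) (l : ℂ) : Prop :=
  ∃ w ∈ tangentVectors C p, w ≠ 0 ∧ tangentMapAt f p w = l • w

theorem HasMultiplier.eq_of_velocity [T2Space X] {C : Set X} {u v : ℂ → X} {f : X → X} {s l a : ℂ}
    (hl : HasMultiplier f C (u s) l) (h : IsParam C u v)
    (ha : tangentMapAt f (u s) (velocity u s) = a • velocity u s) : a = l := by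
  obtain ⟨w, hw, hw0, hwl⟩ := hl
  obtain ⟨c, rfl⟩ := h.exists_eq_smul_velocity hw
  rw [map_smul, ha, smul_comm c a] at hwl
  exact smul_left_injective ℂ hw0 hwl

namespace IsSelfMap

variable {f : X → X} {S C C' : Set X} {η : X → Plane →L[ℂ] Plane →L[ℂ] ℂ}
  {d : ℂ} {p q : X}

theorem multiplier_mul_of_transversal (hη : IsAreaField η) (hf : IsSelfMap f S η d) (hp : p ∈ S)
    (hfp : f p = p) (h : tangentVectors C p ∩ tangentVectors C' p ⊆ {0}) {l l' : ℂ}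
    (hl : HasMultiplier f C p l) (hl' : HasMultiplier f C' p l') : l * l' = d := by
  obtain ⟨w, hw, hw0, hwl⟩ := hl
  obtain ⟨w', hw', hw0', hwl'⟩ := hl'
  have hpb := hf.pullback p hp
  rw [hfp] at hpb
  exact eigenvalue_mul_of_form (hη.alternating p) (hη.ne_zero p) hpb
    (linearIndependent_of_transversal h hw hw' hw0 hw0') hwl hwl'

theorem det_id_sub_of_multiplier (hη : IsAreaField η) (hf : IsSelfMap f S η d) (hp : p ∈ S)
    (hfp : f p = p) {l : ℂ} (hl0 : l ≠ 0) (hl : HasMultiplier f C p l) :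
    (ContinuousLinearMap.id ℂ Plane - tangentMapAt f p).det = (1 - l) * (1 - d / l) := by
  obtain ⟨w, hw, hw0, hwl⟩ := hl
  have hpb := hf.pullback p hp
  rw [hfp] at hpb
  rw [det_id_sub _ hw0 hl0 hwl, det_eq_of_form (hη.alternating p) (hη.ne_zero p) hpb]

variable [T2Space X]

theorem exists_affine (hη : IsAreaField η) (hf : IsSelfMap f S η d) (hd : d ≠ 0) (hCS : C ⊆ S)
    (hfC : Set.MapsTo f C C') {u v u' v' : ℂ → X} (h : IsParam C u v) (h' : IsParam C' u' v')
    (h0 : f (v 0) = v' 0) :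
    ∃ a b : ℂ, a ≠ 0 ∧ (∀ s, f (u s) = u' (a * s + b)) ∧
      tangentMapAt f (v 0) (velocity v 0) = a⁻¹ • velocity v' 0 :=
  h.exists_affine h' (fun _ hp => hf.mdifferentiableAt (hCS hp)) (hf.injOn.mono hCS) hfC h0
    (hf.tangentMapAt_ne_zero hη hd (hCS (h.right_mem 0)) h.velocity_right)

theorem exists_multiplier (hη : IsAreaField η) (hf : IsSelfMap f S η d) (hd : d ≠ 0)
    (hCS : C ⊆ S) (hfC : Set.MapsTo f C C) (hC : IsSmoothRationalCurve C) (hp : p ∈ C)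
    (hfp : f p = p) : ∃ l, l ≠ 0 ∧ HasMultiplier f C p l := by
  obtain ⟨u, v, h⟩ := hC.exists_param
  obtain ⟨u, v, h, rfl⟩ := h.exists_right_eq hp
  obtain ⟨a, b, ha, -, hl⟩ := hf.exists_affine hη hd hCS hfC h h hfp
  exact ⟨a⁻¹, inv_ne_zero ha, velocity v 0, h.swap.velocity_mem 0, h.velocity_right, hl⟩

/-- With the two fixed points placed at `0` and `∞` the map is multiplication by `l`, whose
multiplier at `∞` is `l⁻¹`. -/
theorem exists_linear (hη : IsAreaField η) (hf : IsSelfMap f S η d) (hd : d ≠ 0)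
    (hCS : C ⊆ S) (hfC : Set.MapsTo f C C) (hC : IsSmoothRationalCurve C) (hp : p ∈ C)
    (hq : q ∈ C) (hpq : p ≠ q) (hfp : f p = p) (hfq : f q = q) {l : ℂ}
    (hl : HasMultiplier f C p l) :
    ∃ u v, IsParam C u v ∧ u 0 = p ∧ v 0 = q ∧ l ≠ 0 ∧ (∀ s, f (u s) = u (l * s)) ∧
      HasMultiplier f C q l⁻¹ := by
  obtain ⟨u, v, h⟩ := hC.exists_param
  obtain ⟨u, v, h, rfl, rfl⟩ := h.exists_left_right_eq hp hq hpq
  obtain ⟨a, b, ha, hab, hv⟩ := hf.exists_affine hη hd hCS hfC h h hfq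
  have hb : b = 0 := by
    have := hab 0
    rw [hfp, mul_zero, zero_add] at this
    exact (h.inj this).symm
  subst hb
  simp only [add_zero] at hab
  have hal : a = l := by
    refine hl.eq_of_velocity h ?_
    rw [← velocity_comp_left (hf.mdifferentiableAt (hCS hp)) (h.mdifferentiable_left 0)]
    simp only [hab]
    rw [velocity_comp_right (φ := fun s => a * s) (c := a) (h.mdifferentiable_left _) (by
      simpa using (hasDerivAt_id (0 : ℂ)).const_mul a), mul_zero]
  subst hal
  exact ⟨u, v, h, rfl, rfl, ha, hab, velocity v 0, h.swap.velocity_mem 0, h.velocity_right, hv⟩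

theorem hasMultiplier_inv (hη : IsAreaField η) (hf : IsSelfMap f S η d) (hd : d ≠ 0)
    (hCS : C ⊆ S) (hfC : Set.MapsTo f C C) (hC : IsSmoothRationalCurve C) (hp : p ∈ C)
    (hq : q ∈ C) (hpq : p ≠ q) (hfp : f p = p) (hfq : f q = q) {l : ℂ}
    (hl : HasMultiplier f C p l) : HasMultiplier f C q l⁻¹ := by
  obtain ⟨u, v, -, -, -, -, -, h⟩ := hf.exists_linear hη hd hCS hfC hC hp hq hpq hfp hfq hl
  exact h

theorem eq_self_of_multiplier_one (hη : IsAreaField η) (hf : IsSelfMap f S η d) (hd : d ≠ 0)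
    (hCS : C ⊆ S) (hfC : Set.MapsTo f C C) (hC : IsSmoothRationalCurve C) (hp : p ∈ C)
    (hq : q ∈ C) (hpq : p ≠ q) (hfp : f p = p) (hfq : f q = q)
    (hl : HasMultiplier f C p 1) {x : X} (hx : x ∈ C) : f x = x := by
  obtain ⟨u, v, h, rfl, rfl, -, hu, -⟩ :=
    hf.exists_linear hη hd hCS hfC hC hp hq hpq hfp hfq hl
  by_cases hxv : x = v 0
  · rw [hxv, hfq]
  · obtain ⟨s, rfl⟩ := h.eq_left_of_mem hx hxv
    rw [hu, one_mul]

theorem eq_or_eq_of_fixed (hη : IsAreaField η) (hf : IsSelfMap f S η d) (hd : d ≠ 0)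
    (hCS : C ⊆ S) (hfC : Set.MapsTo f C C) (hC : IsSmoothRationalCurve C) (hp : p ∈ C)
    (hq : q ∈ C) (hpq : p ≠ q) (hfp : f p = p) (hfq : f q = q) {l : ℂ}
    (hl : HasMultiplier f C p l) (hl1 : l ≠ 1) {x : X} (hx : x ∈ C) (hfx : f x = x) :
    x = p ∨ x = q := by
  obtain ⟨u, v, h, rfl, rfl, -, hu, -⟩ :=
    hf.exists_linear hη hd hCS hfC hC hp hq hpq hfp hfq hl
  by_cases hxv : x = v 0
  · exact Or.inr hxv
  · obtain ⟨s, rfl⟩ := h.eq_left_of_mem hx hxv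
    rw [hu] at hfx
    have hs : (l - 1) * s = 0 := by linear_combination h.inj hfx
    rw [(mul_eq_zero.1 hs).resolve_left (sub_ne_zero.2 hl1)]
    exact Or.inl rfl

/-- With `p` at infinity the map is `s ↦ a * s + b` with `a ≠ 1`, which has a finite fixed point. -/
theorem exists_other_fixed (hη : IsAreaField η) (hf : IsSelfMap f S η d) (hd : d ≠ 0)
    (hCS : C ⊆ S) (hfC : Set.MapsTo f C C) (hC : IsSmoothRationalCurve C) (hp : p ∈ C)
    (hfp : f p = p) {l : ℂ} (hl : HasMultiplier f C p l) (hl1 : l ≠ 1) :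
    ∃ q ∈ C, q ≠ p ∧ f q = q := by
  obtain ⟨u, v, h⟩ := hC.exists_param
  obtain ⟨u, v, h, rfl⟩ := h.exists_right_eq hp
  obtain ⟨a, b, ha, hab, hv⟩ := hf.exists_affine hη hd hCS hfC h h hfp
  have hal := hl.eq_of_velocity h.swap hv
  have ha1 : 1 - a ≠ 0 := by
    intro h1
    rw [← sub_eq_zero.1 h1, inv_one] at hal
    exact hl1 hal.symm
  refine ⟨u (b / (1 - a)), h.left_mem _, (h.right_zero_ne _).symm, ?_⟩
  rw [hab]
  congr 1
  field_simp
  ring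

/-- With `p` at `0` and `q` at `∞`, a map exchanging them is `s ↦ 1 / (a * s)`; this makes it an
involution with two fixed points. -/
theorem exists_swap_linear (hη : IsAreaField η) (hf : IsSelfMap f S η d) (hd : d ≠ 0)
    (hCS : C ⊆ S) (hfC : Set.MapsTo f C C) (hC : IsSmoothRationalCurve C) (hp : p ∈ C)
    (hq : q ∈ C) (hpq : p ≠ q) (hfp : f p = q) (hfq : f q = p) :
    ∃ u v, IsParam C u v ∧ u 0 = p ∧ v 0 = q ∧ ∃ a : ℂ, a ≠ 0 ∧ ∀ s, f (u s) = v (a * s) := by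
  obtain ⟨u, v, h⟩ := hC.exists_param
  obtain ⟨u, v, h, rfl, rfl⟩ := h.exists_left_right_eq hp hq hpq
  obtain ⟨a, b, ha, hab, hv⟩ := hf.exists_affine hη hd hCS hfC h h.swap hfq
  have hb : b = 0 := by
    have := hab 0
    rw [hfp, mul_zero, zero_add] at this
    exact (h.swap.inj this).symm
  subst hb
  simp only [add_zero] at hab
  exact ⟨u, v, h, rfl, rfl, a, ha, hab⟩

theorem involutive_of_swap (hη : IsAreaField η) (hf : IsSelfMap f S η d) (hd : d ≠ 0)
    (hCS : C ⊆ S) (hfC : Set.MapsTo f C C) (hC : IsSmoothRationalCurve C) (hp : p ∈ C)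
    (hq : q ∈ C) (hpq : p ≠ q) (hfp : f p = q) (hfq : f q = p) {x : X} (hx : x ∈ C) :
    f (f x) = x := by
  obtain ⟨u, v, h, rfl, rfl, a, ha, hu⟩ :=
    hf.exists_swap_linear hη hd hCS hfC hC hp hq hpq hfp hfq
  by_cases hxv : x = v 0
  · rw [hxv, hfq, hfp]
  · obtain ⟨s, rfl⟩ := h.eq_left_of_mem hx hxv
    rcases eq_or_ne s 0 with rfl | hs
    · rw [hfp, hfq]
    · rw [hu, h.glue _ (mul_ne_zero ha hs), hu, h.glue _ (by positivity)]
      congr 1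
      field_simp

theorem exists_fixed_of_swap (hη : IsAreaField η) (hf : IsSelfMap f S η d) (hd : d ≠ 0)
    (hCS : C ⊆ S) (hfC : Set.MapsTo f C C) (hC : IsSmoothRationalCurve C) (hp : p ∈ C)
    (hq : q ∈ C) (hpq : p ≠ q) (hfp : f p = q) (hfq : f q = p) :
    ∃ x ∈ C, ∃ y ∈ C, x ≠ y ∧ (∀ z ∈ C, f z = z ↔ z = x ∨ z = y) ∧
      HasMultiplier f C x (-1) ∧ HasMultiplier f C y (-1) := by
  obtain ⟨u, v, h, rfl, rfl, a, ha, hu⟩ :=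
    hf.exists_swap_linear hη hd hCS hfC hC hp hq hpq hfp hfq
  -- The fixed points of `s ↦ 1 / (a * s)` are the two roots `±r` of `a * s ^ 2 = 1`.
  obtain ⟨r, hr⟩ := IsSquare.exists_sq a⁻¹ (IsAlgClosed.exists_eq_mul_self a⁻¹)
  have hr0 : r ≠ 0 := by rintro rfl; simp at hr; exact ha hr
  have hara : a * r ^ 2 = 1 := by rw [← hr, mul_inv_cancel₀ ha]
  have hfix : ∀ s, s ≠ 0 → (f (u s) = u s ↔ a * s ^ 2 = 1) := fun s hs => by
    rw [hu, h.glue _ (mul_ne_zero ha hs), h.inj.eq_iff, inv_eq_iff_eq_inv, sq, ← mul_assoc,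
      mul_eq_one_iff_eq_inv₀ hs]
  have hmul : ∀ s, a * s ^ 2 = 1 → HasMultiplier f C (u s) (-1) := fun s hs => by
    have hs0 : s ≠ 0 := by rintro rfl; simp at hs
    refine ⟨velocity u s, h.velocity_mem s, h.velocity_left s, ?_⟩
    rw [← velocity_comp_left (hf.mdifferentiableAt (hCS (h.left_mem s)))
      (h.mdifferentiable_left s)]
    have he : (fun t => f (u t)) =ᶠ[𝓝 s] fun t => u (a * t)⁻¹ := by
      filter_upwards [isOpen_ne.mem_nhds hs0] with t ht
      rw [hu, h.glue _ (mul_ne_zero ha ht)]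
    -- The derivative is `-1 / (a * s ^ 2)`.
    have hd' : HasDerivAt (fun t : ℂ => (a * t)⁻¹) (-1) s := by
      have := ((hasDerivAt_id s).const_mul a).fun_inv (mul_ne_zero ha hs0)
      have h2 : (a * id s) ^ 2 = a := by simp only [id]; linear_combination a * hs
      rw [h2, mul_one, neg_div, div_self ha] at this
      exact this
    have hfs : (a * s)⁻¹ = s := by
      rw [inv_eq_iff_eq_inv, ← mul_eq_one_iff_eq_inv₀ hs0, mul_assoc, ← sq, hs]
    rw [velocity_congr he, velocity_comp_right (h.mdifferentiable_left _) hd', hfs]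
  refine ⟨u r, h.left_mem r, u (-r), h.left_mem _, fun he => hr0 ?_, fun z hz => ?_, hmul r hara,
    hmul (-r) (by rw [neg_sq, hara])⟩
  · have := h.inj he
    linear_combination this / 2
  · by_cases hzv : z = v 0
    · subst hzv
      rw [hfq]
      refine iff_of_false (h.right_zero_ne 0).symm ?_
      rintro (h1 | h1) <;> exact h.right_zero_ne _ h1
    · obtain ⟨s, rfl⟩ := h.eq_left_of_mem hz hzv
      rw [h.inj.eq_iff, h.inj.eq_iff]
      rcases eq_or_ne s 0 with rfl | hs
      · rw [hfp]
        refine iff_of_false (Ne.symm hzv) ?_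
        rintro (h1 | h1)
        · exact hr0 h1.symm
        · exact hr0 (neg_eq_zero.1 h1.symm)
      · rw [hfix s hs, ← hara, mul_right_inj' ha, sq_eq_sq_iff_eq_or_eq_neg]

theorem exists_swap_tangents (hf : IsSelfMap f S η d) (hp : p ∈ S)
    (hfp : f p = p) (hC : IsSmoothRationalCurve C) (hC' : IsSmoothRationalCurve C') (hpC : p ∈ C)
    (hpC' : p ∈ C') (hCC' : Set.MapsTo f C C') (hC'C : Set.MapsTo f C' C)
    (h : tangentVectors C p ∩ tangentVectors C' p ⊆ {0}) :
    ∃ w ∈ tangentVectors C p, w ≠ 0 ∧ ∃ w', LinearIndependent ℂ ![w, w'] ∧ ∃ a b : ℂ,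
      tangentMapAt f p w = a • w' ∧ tangentMapAt f p w' = b • w := by
  obtain ⟨w, hw, hw0⟩ := hC.exists_tangent_ne_zero hpC
  obtain ⟨w', hw', hw0'⟩ := hC'.exists_tangent_ne_zero hpC'
  have h1 := tangentMapAt_mem_tangentVectors (hf.smooth p hp) hCC' hw
  have h2 := tangentMapAt_mem_tangentVectors (hf.smooth p hp) hC'C hw'
  rw [hfp] at h1 h2
  obtain ⟨a, ha⟩ := hC'.exists_eq_smul hpC' hw' hw0' h1
  obtain ⟨b, hb⟩ := hC.exists_eq_smul hpC hw hw0 h2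
  exact ⟨w, hw, hw0, w', linearIndependent_of_transversal h hw hw' hw0 hw0', a, b, ha, hb⟩

/-- The derivative exchanges the tangent lines with factors `a` and `b`, so its square is `a * b`,
and the area form gives `a * b = -d`. -/
theorem hasMultiplier_sq_of_swap (hη : IsAreaField η) (hf : IsSelfMap f S η d) (hp : p ∈ S)
    (hfp : f p = p) (hC : IsSmoothRationalCurve C) (hC' : IsSmoothRationalCurve C') (hpC : p ∈ C)
    (hpC' : p ∈ C') (hCC' : Set.MapsTo f C C') (hC'C : Set.MapsTo f C' C)
    (h : tangentVectors C p ∩ tangentVectors C' p ⊆ {0}) : HasMultiplier (f ∘ f) C p (-d) := by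
  obtain ⟨w, hw, hw0, w', hli, a, b, ha, hb⟩ :=
    hf.exists_swap_tangents hp hfp hC hC' hpC hpC' hCC' hC'C h
  have hpb := hf.pullback p hp
  rw [hfp] at hpb
  have hab := swap_mul_of_form (hη.alternating p) (hη.ne_zero p) hpb hli ha hb
  refine ⟨w, hw, hw0, ?_⟩
  have hmd := hf.mdifferentiableAt hp
  rw [tangentMapAt_comp (by rwa [hfp]) hmd, hfp, ha, map_smul, hb, smul_smul, hab]

theorem det_id_sub_of_swap (hη : IsAreaField η) (hf : IsSelfMap f S η d) (hd : d ≠ 0)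
    (hp : p ∈ S) (hfp : f p = p) (hC : IsSmoothRationalCurve C) (hC' : IsSmoothRationalCurve C')
    (hpC : p ∈ C) (hpC' : p ∈ C') (hCC' : Set.MapsTo f C C') (hC'C : Set.MapsTo f C' C)
    (h : tangentVectors C p ∩ tangentVectors C' p ⊆ {0}) :
    (ContinuousLinearMap.id ℂ Plane - tangentMapAt f p).det = 1 + d := by
  obtain ⟨w, hw, hw0, w', hli, a, b, ha, hb⟩ :=
    hf.exists_swap_tangents hp hfp hC hC' hpC hpC' hCC' hC'C h
  have hpb := hf.pullback p hp
  rw [hfp] at hpb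
  exact TypeAComponent.det_id_sub_of_swap (hη.alternating p) (hη.ne_zero p) hpb hd hli ha hb

end IsSelfMap

theorem HasMultiplier.iterate {f : X → X} {S C : Set X} {η : X → Plane →L[ℂ] Plane →L[ℂ] ℂ}
    {d l : ℂ} {p : X} (hl : HasMultiplier f C p l) (hf : IsSelfMap f S η d) (hp : p ∈ S)
    (hfp : f p = p) (m : ℕ) : HasMultiplier f^[m] C p (l ^ m) := by
  obtain ⟨w, hw, hw0, hwl⟩ := hl
  refine ⟨w, hw, hw0, ?_⟩
  induction m with
  | zero => rw [pow_zero, one_smul]; exact tangentMapAt_id p w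
  | succ m ih =>
    have hfm : f^[m] p = p := Function.iterate_fixed hfp m
    rw [Function.iterate_succ', tangentMapAt_comp (by rw [hfm]; exact hf.mdifferentiableAt hp)
      ((hf.iterate m).mdifferentiableAt hp), hfm, ih, map_smul, hwl, smul_smul, pow_succ]

end

/-! ### Reversal of the diagram and the algebra of the chain of multipliers -/

section

/-- Successive images differ by `±1` and injectivity forbids turning back, so `σ` is affine with
slope `1` or `-1`. Slope `1` leaves only the identity. -/
theorem pathGraph_aut_apply_eq_rev {n : ℕ}
    (σ : SimpleGraph.pathGraph n ≃g SimpleGraph.pathGraph n) (hσ : orderOf σ = 2) (i : Fin n) :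
    σ i = i.rev := by
  have hσ1 : σ ≠ 1 := by rintro rfl; simp at hσ
  have hn : 2 ≤ n := by
    by_contra! h
    have : Subsingleton (Fin n) := Fin.subsingleton_iff_le_one.2 (by omega)
    exact hσ1 (RelIso.ext fun x => Subsingleton.elim _ _)
  have hstep : ∀ k (hk : k + 1 < n), ((σ ⟨k, by omega⟩ : Fin n) : ℕ) + 1 = σ ⟨k + 1, hk⟩ ∨
      ((σ ⟨k + 1, hk⟩ : Fin n) : ℕ) + 1 = σ ⟨k, by omega⟩ := fun k hk => by
    have : (SimpleGraph.pathGraph n).Adj ⟨k, by omega⟩ ⟨k + 1, hk⟩ :=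
      SimpleGraph.pathGraph_adj.2 (Or.inl rfl)
    exact SimpleGraph.pathGraph_adj.1 (σ.map_adj_iff.2 this)
  have hinj : ∀ k (hk : k + 2 < n),
      ((σ ⟨k, by omega⟩ : Fin n) : ℕ) ≠ σ ⟨k + 2, hk⟩ := fun k hk h => by
    have := σ.injective (Fin.ext h)
    simp at this
  obtain ⟨d, hd, hd1⟩ : ∃ d : ℤ, (d = 1 ∨ d = -1) ∧
      ((σ ⟨1, by omega⟩ : Fin n) : ℤ) = (σ ⟨0, by omega⟩ : Fin n) + d := by
    rcases hstep 0 (by omega) with h | h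
    · exact ⟨1, Or.inl rfl, by simp only [zero_add] at h; omega⟩
    · exact ⟨-1, Or.inr rfl, by simp only [zero_add] at h; omega⟩
  have hlin : ∀ k (hk : k < n),
      ((σ ⟨k, hk⟩ : Fin n) : ℤ) = (σ ⟨0, by omega⟩ : Fin n) + d * k := by
    intro k
    induction k using Nat.twoStepInduction with
    | zero => intro hk; simp
    | one => intro hk; simpa using hd1
    | more k h0 h1 =>
      intro hk
      have e0 := h0 (by omega)
      have e1 := h1 (by omega)
      have hne := hinj k hk
      have hs := hstep (k + 1) (by omega)
      simp only [add_assoc, one_add_one_eq_two] at hs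
      push_cast at e1 ⊢
      rcases hd with rfl | rfl <;> omega
  have hlast := hlin (n - 1) (by omega)
  have hb0 := (σ ⟨0, by omega⟩).2
  have hb1 := (σ ⟨n - 1, by omega⟩).2
  rcases hd with rfl | rfl
  · refine absurd (RelIso.ext fun x => Fin.ext ?_) hσ1
    have := hlin x x.2
    simp only [RelIso.coe_one, id]
    rw [Fin.eta] at this
    omega
  · have := hlin i i.2
    rw [Fin.eta] at this
    apply Fin.ext
    rw [Fin.val_rev]
    have := i.2
    omega

/-- The multipliers along a chain of `n` curves. -/
def chainMultiplier (B C : ℂ) (n i : ℕ) : ℂ := C * B ^ (2 * i - n - 1 : ℤ)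

section Chain

variable {B C : ℂ} {n : ℕ}

theorem chainMultiplier_ne_zero (hB0 : B ≠ 0) (hC : C ^ 2 = 1) (i : ℕ) :
    chainMultiplier B C n i ≠ 0 := by
  refine mul_ne_zero ?_ (zpow_ne_zero _ hB0)
  rintro rfl
  simp at hC

theorem chainMultiplier_succ (hB0 : B ≠ 0) (i : ℕ) :
    chainMultiplier B C n (i + 1) = B ^ 2 * chainMultiplier B C n i := by
  unfold chainMultiplier
  rw [mul_left_comm, ← zpow_natCast B 2, ← zpow_add₀ hB0]
  congr 2
  push_cast
  ring

/-- Squaring removes the sign `C`, and `B` is not a root of unity, so the exponent `2 * i - n - 1`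
vanishes: only the middle of an odd chain can have multiplier 1. -/
theorem chainMultiplier_eq_one (hC : C ^ 2 = 1) (hB : ∀ e : ℤ, B ^ e = 1 → e = 0) {i : ℕ}
    (h : chainMultiplier B C n i = 1) : 2 * i = n + 1 ∧ C = 1 := by
  unfold chainMultiplier at h
  have h2 : B ^ ((2 * i - n - 1 : ℤ) * (2 : ℕ)) = 1 := by
    rw [zpow_mul, zpow_natCast]
    calc (B ^ (2 * i - n - 1 : ℤ)) ^ 2 = C ^ 2 * (B ^ (2 * i - n - 1 : ℤ)) ^ 2 := by
          rw [hC, one_mul]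
      _ = 1 := by rw [← mul_pow, h, one_pow]
  have he : (2 * i - n - 1 : ℤ) = 0 := by
    have := hB _ h2
    push_cast at this
    omega
  refine ⟨by omega, ?_⟩
  rwa [he, zpow_zero, mul_one] at h

/-- A partial fraction decomposition. With `y` the `i`-th multiplier and `B ^ 2 * y` the next one,
the right-hand side is a difference of consecutive terms, so the sum over the chain telescopes. -/
theorem index_term_eq (hB0 : B ≠ 0) (hB2 : B ^ 2 ≠ 1) {y : ℂ} (hy : y ≠ 0) (h1 : y ≠ 1)
    (h2 : B ^ 2 * y ≠ 1) :
    B * ((1 - B ^ 2 * y) * (1 - B ^ 2 / (B ^ 2 * y)))⁻¹ =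
      -B / (B ^ 2 - 1) * ((1 - B ^ 2 * y)⁻¹ - (1 - y)⁻¹) := by
  have e1 : 1 - y ≠ 0 := sub_ne_zero.2 (Ne.symm h1)
  have e2 : 1 - B ^ 2 * y ≠ 0 := sub_ne_zero.2 (Ne.symm h2)
  have e3 : B ^ 2 - 1 ≠ 0 := sub_ne_zero.2 hB2
  have e4 : 1 - B ^ 2 / (B ^ 2 * y) = -(1 - y) / y := by field_simp; ring
  rw [e4]
  field_simp
  ring

theorem boundary_term_eq (hB0 : B ≠ 0) (hC : C ^ 2 = 1) (hB2 : B ^ 2 ≠ 1)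
    (hY : C * B ^ (n + 1) ≠ 1) :
    -B / (B ^ 2 - 1) * ((1 - chainMultiplier B C n (n + 1))⁻¹ -
      (1 - chainMultiplier B C n 0)⁻¹) =
      (1 + C * B ^ (n + 1)) / ((C * B ^ (n + 1) - 1) * (B - B⁻¹)) := by
  have h1 : chainMultiplier B C n (n + 1) = C * B ^ (n + 1) := by
    unfold chainMultiplier
    rw [← zpow_natCast B (n + 1)]
    congr 2
    push_cast
    ring
  have hC0 : C ≠ 0 := by rintro rfl; simp at hC
  have h0 : chainMultiplier B C n 0 = (C * B ^ (n + 1))⁻¹ := by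
    unfold chainMultiplier
    rw [mul_inv, ← zpow_natCast B (n + 1), ← zpow_neg, inv_eq_of_mul_eq_one_left (a := C) (b := C)
      (by rw [← sq, hC])]
    congr 2
    push_cast
    ring
  rw [h0, h1]
  have hY0 : C * B ^ (n + 1) ≠ 0 := mul_ne_zero hC0 (pow_ne_zero _ hB0)
  generalize C * B ^ (n + 1) = Y at *
  have e1 : Y - 1 ≠ 0 := sub_ne_zero.2 hY
  have e2 : 1 - Y ≠ 0 := sub_ne_zero.2 (Ne.symm hY)
  have e3 : B ^ 2 - 1 ≠ 0 := sub_ne_zero.2 hB2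
  have e4 : 1 - Y⁻¹ = (Y - 1) / Y := by field_simp
  have e5 : B - B⁻¹ = (B ^ 2 - 1) / B := by field_simp
  rw [e4, e5, ← neg_sub Y 1]
  field_simp
  ring

/-- As `C ^ 2 = 1`, the denominator is a square: with `P = B ^ (n + 1)`, `P + P⁻¹ - 2 * C = (P - C)
^ 2 / P`. The factor `k` stands for the value of `K n` at `B + B⁻¹`. -/
theorem sub_ne_zero_and_div_eq (hB0 : B ≠ 0) (hC : C ^ 2 = 1) (hB2 : B ^ 2 ≠ 1)
    (hY : C * B ^ (n + 1) ≠ 1) {k : ℂ} (hk : (B - B⁻¹) * k = B ^ (n + 1) - B⁻¹ ^ (n + 1)) :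
    B ^ (n + 1) + B⁻¹ ^ (n + 1) - 2 * C ≠ 0 ∧
      (1 + C * B ^ (n + 1)) / ((C * B ^ (n + 1) - 1) * (B - B⁻¹)) =
        k / (B ^ (n + 1) + B⁻¹ ^ (n + 1) - 2 * C) := by
  rw [inv_pow] at *
  have hP0 : B ^ (n + 1) ≠ 0 := pow_ne_zero _ hB0
  generalize B ^ (n + 1) = P at *
  have hPC : P - C ≠ 0 := by
    intro h
    rw [sub_eq_zero.1 h, ← sq] at hY
    exact hY hC
  have hden : P + P⁻¹ - 2 * C = (P - C) ^ 2 / P := by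
    field_simp
    linear_combination -hC
  have e1 : C * P - 1 ≠ 0 := sub_ne_zero.2 hY
  have e5 : B - B⁻¹ ≠ 0 := by
    have : B - B⁻¹ = (B ^ 2 - 1) / B := by field_simp
    rw [this]
    exact div_ne_zero (sub_ne_zero.2 hB2) hB0
  rw [hden]
  refine ⟨div_ne_zero (pow_ne_zero _ hPC) hP0, ?_⟩
  rw [div_eq_div_iff (mul_ne_zero e1 e5) (div_ne_zero (pow_ne_zero _ hPC) hP0)]
  have : k * ((C * P - 1) * (B - B⁻¹)) = (C * P - 1) * (P - P⁻¹) := by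
    linear_combination (C * P - 1) * hk
  rw [this]
  field_simp
  linear_combination (1 + C * P - 2 * P ^ 2) * hC

/-- The indices of the isolated fixed points in a chain. -/
def isolatedIndices (B C : ℂ) (n : ℕ) : Finset ℕ := by
  classical exact {i ∈ Finset.range (n + 1) |
    chainMultiplier B C n i ≠ 1 ∧ chainMultiplier B C n (i + 1) ≠ 1}

theorem mem_isolatedIndices {i : ℕ} : i ∈ isolatedIndices B C n ↔
    i < n + 1 ∧ chainMultiplier B C n i ≠ 1 ∧ chainMultiplier B C n (i + 1) ≠ 1 := by
  classical
  simp [isolatedIndices]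

/-- The contribution of the `i`-th fixed point of a chain to the holomorphic index. -/
def indexTerm (B C : ℂ) (n i : ℕ) : ℂ :=
  B * ((1 - chainMultiplier B C n (i + 1)) * (1 - B ^ 2 / chainMultiplier B C n (i + 1)))⁻¹

theorem indexTerm_eq (hB0 : B ≠ 0) (hC : C ^ 2 = 1) (hB2 : B ^ 2 ≠ 1) {i : ℕ}
    (h1 : chainMultiplier B C n i ≠ 1) (h2 : chainMultiplier B C n (i + 1) ≠ 1) :
    indexTerm B C n i = -B / (B ^ 2 - 1) *
      ((1 - chainMultiplier B C n (i + 1))⁻¹ - (1 - chainMultiplier B C n i)⁻¹) := by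
  rw [chainMultiplier_succ hB0] at h2
  rw [indexTerm, chainMultiplier_succ hB0]
  exact index_term_eq hB0 hB2 (chainMultiplier_ne_zero hB0 hC i) h1 h2

theorem isolatedIndices_of_even (hC : C ^ 2 = 1) (hB : ∀ e : ℤ, B ^ e = 1 → e = 0)
    (hn : Even n) : isolatedIndices B C n = Finset.range (n + 1) := by
  have h : ∀ i, chainMultiplier B C n i ≠ 1 := fun i hi => by
    have := (chainMultiplier_eq_one hC hB hi).1
    obtain ⟨k, rfl⟩ := hn
    omega
  ext i
  simp [mem_isolatedIndices, h]

theorem chainMultiplier_mid {k : ℕ} : chainMultiplier B 1 (2 * k + 1) (k + 1) = 1 := by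
  unfold chainMultiplier
  have : (2 * (k + 1 : ℕ) - (2 * k + 1 : ℕ) - 1 : ℤ) = 0 := by push_cast; ring
  rw [this, zpow_zero, mul_one]

theorem isolatedIndices_of_odd (hB : ∀ e : ℤ, B ^ e = 1 → e = 0) {k : ℕ} :
    isolatedIndices B 1 (2 * k + 1) = Finset.range (2 * k + 1 + 1) \ {k, k + 1} := by
  have h : ∀ i, chainMultiplier B 1 (2 * k + 1) i = 1 ↔ i = k + 1 := fun i => by
    refine ⟨fun hi => ?_, ?_⟩
    · have := (chainMultiplier_eq_one (one_pow 2) hB hi).1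
      omega
    · rintro rfl
      exact chainMultiplier_mid
  ext i
  simp [mem_isolatedIndices, h]
  omega

theorem sum_indexTerm_of_even (hB0 : B ≠ 0) (hC : C ^ 2 = 1) (hB : ∀ e : ℤ, B ^ e = 1 → e = 0)
    (hn : Even n) (hB2 : B ^ 2 ≠ 1) (hY : C * B ^ (n + 1) ≠ 1) :
    ∑ i ∈ isolatedIndices B C n, indexTerm B C n i =
      (1 + C * B ^ (n + 1)) / ((C * B ^ (n + 1) - 1) * (B - B⁻¹)) := by
  rw [Finset.sum_congr rfl fun i hi => indexTerm_eq hB0 hC hB2 (mem_isolatedIndices.1 hi).2.1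
    (mem_isolatedIndices.1 hi).2.2, isolatedIndices_of_even hC hB hn, ← Finset.mul_sum,
    Finset.sum_range_sub fun i => (1 - chainMultiplier B C n i)⁻¹,
    boundary_term_eq hB0 hC hB2 hY]

/-- The points `k` and `k + 1` on the fixed curve are missing from the sum. Their share of the
telescoping sum involves only the multipliers `(B ^ 2)⁻¹` and `B ^ 2` next to the middle, and equals
the contribution of the fixed curve. -/
theorem sum_indexTerm_of_odd (hB0 : B ≠ 0) (hB : ∀ e : ℤ, B ^ e = 1 → e = 0) {k : ℕ}
    (hB2 : B ^ 2 ≠ 1) (hY : 1 * B ^ (2 * k + 1 + 1) ≠ 1) :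
    ∑ i ∈ isolatedIndices B 1 (2 * k + 1), indexTerm B 1 (2 * k + 1) i +
      B * ((B ^ 2 + 1) / (B ^ 2 - 1) ^ 2) =
      (1 + 1 * B ^ (2 * k + 1 + 1)) / ((1 * B ^ (2 * k + 1 + 1) - 1) * (B - B⁻¹)) := by
  have hsub : ({k, k + 1} : Finset ℕ) ⊆ Finset.range (2 * k + 1 + 1) := by
    intro i hi
    simp only [Finset.mem_insert, Finset.mem_singleton] at hi
    rw [Finset.mem_range]
    omega
  -- The pole at the middle multiplier 1 has the default value of an inverse of zero, but it occurs
  -- with both signs in the two removed terms and cancels.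
  rw [Finset.sum_congr rfl fun i hi => indexTerm_eq hB0 (one_pow 2) hB2
    (mem_isolatedIndices.1 hi).2.1 (mem_isolatedIndices.1 hi).2.2, isolatedIndices_of_odd hB,
    ← Finset.mul_sum, Finset.sum_sdiff_eq_sub hsub,
    Finset.sum_range_sub fun i => (1 - chainMultiplier B 1 (2 * k + 1) i)⁻¹, mul_sub,
    boundary_term_eq hB0 (one_pow 2) hB2 hY, Finset.sum_pair (by omega), sub_add_sub_cancel']
  have h1 := chainMultiplier_mid (B := B) (k := k)
  have h2 := chainMultiplier_succ (C := 1) (n := 2 * k + 1) hB0 (k + 1)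
  have h0 := chainMultiplier_succ (C := 1) (n := 2 * k + 1) hB0 k
  have hB20 : B ^ 2 ≠ 0 := pow_ne_zero _ hB0
  rw [h1, mul_one] at h2
  rw [h1] at h0
  rw [h2, eq_inv_of_mul_eq_one_right h0.symm]
  have e3 : B ^ 2 - 1 ≠ 0 := sub_ne_zero.2 hB2
  have e4 : 1 - (B ^ 2)⁻¹ = (B ^ 2 - 1) / B ^ 2 := by field_simp
  rw [e4, ← neg_sub (B ^ 2) 1, inv_neg]
  rw [sub_add_eq_add_sub, sub_eq_iff_eq_add, add_right_inj]
  field_simp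
  ring

end Chain

end

/-! ### The chain of fixed points of a map preserving every curve -/

section

variable {X : Type*} [TopologicalSpace X] [ChartedSpace Plane X]

theorem HasMultiplier.unique [T2Space X] {f : X → X} {C : Set X} {p : X} {l k : ℂ}
    (hC : IsSmoothRationalCurve C) (hp : p ∈ C) (hl : HasMultiplier f C p l)
    (hk : HasMultiplier f C p k) : l = k := by
  obtain ⟨w, hw, hw0, hwl⟩ := hl
  obtain ⟨w', hw', hw0', hwk⟩ := hk
  obtain ⟨c, rfl⟩ := hC.exists_eq_smul hp hw hw0 hw'
  rw [map_smul, hwl, smul_comm c l] at hwk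
  exact smul_left_injective ℂ hw0' hwk

theorem hasMultiplier_one_of_fixed {f : X → X} {C : Set X} {p : X}
    (hC : IsSmoothRationalCurve C) (hp : p ∈ C) (hf : ∀ x ∈ C, f x = x)
    (hd : MDifferentiableAt 𝓘(ℂ, Plane) 𝓘(ℂ, Plane) f p) : HasMultiplier f C p 1 := by
  obtain ⟨u, v, h⟩ := hC.exists_param
  obtain ⟨u, v, h, rfl⟩ := h.exists_right_eq hp
  refine ⟨velocity v 0, h.swap.velocity_mem 0, h.velocity_right, ?_⟩
  rw [one_smul, ← velocity_comp_left hd (h.mdifferentiable_right 0)]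
  exact velocity_congr (Filter.Eventually.of_forall fun t => hf _ (h.right_mem t))

section TypeA

variable {n : ℕ} {E : Fin n → Set X}

theorem IsTypeA.exists_node (hE : IsTypeA E) {i : ℕ} (hi : i + 1 < n) :
    ∃ p, E ⟨i, by omega⟩ ∩ E ⟨i + 1, hi⟩ = {p} ∧
      tangentVectors (E ⟨i, by omega⟩) p ∩ tangentVectors (E ⟨i + 1, hi⟩) p ⊆ {0} :=
  hE.adjacent _ _ (SimpleGraph.pathGraph_adj.2 (Or.inl rfl))

theorem IsTypeA.disjoint_of_lt (hE : IsTypeA E) {i j : Fin n} (hij : (i : ℕ) + 1 < j) :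
    Disjoint (E i) (E j) := by
  refine hE.disjoint i j (fun h => by rw [h] at hij; omega) fun h => ?_
  rcases SimpleGraph.pathGraph_adj.1 h with h | h <;> omega

/-- `q 0, …, q n` are fixed points of `f` on the chain `E`: the nodes of the chain and one further
point on either end, with multipliers `chainMultiplier B C n`. -/
structure IsFixedChain (f : X → X) (E : Fin n → Set X) (B C : ℂ) (q : ℕ → X) : Prop where
  left_mem : ∀ i (hi : i < n), q i ∈ E ⟨i, hi⟩
  right_mem : ∀ i (hi : i < n), q (i + 1) ∈ E ⟨i, hi⟩
  ne : ∀ i, i < n → q i ≠ q (i + 1)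
  fixed : ∀ i, i ≤ n → f (q i) = q i
  multiplier : ∀ i (hi : i < n), HasMultiplier f (E ⟨i, hi⟩) (q i) (chainMultiplier B C n (i + 1))

variable {f : X → X} {η : X → Plane →L[ℂ] Plane →L[ℂ] ℂ} {B C : ℂ} {q : ℕ → X}

/-- Crossing a node replaces a multiplier `l` by `B ^ 2 / l`, and passing to the other fixed point
of a curve inverts it. Hence one multiplier determines all of them, and `hmid` supplies it at the
centre. The ends of the chain are the second fixed points of the two extremal curves. -/
theorem exists_isFixedChain [T2Space X] (hη : IsAreaField η) (hE : IsTypeA E) (hn : 2 ≤ n)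
    (hf : IsSelfMap f (⋃ i, E i) η (B ^ 2)) (hfE : ∀ i, Set.MapsTo f (E i) (E i)) (hB0 : B ≠ 0)
    (hC : C ^ 2 = 1) (hB : ∀ e : ℤ, B ^ e = 1 → e = 0)
    (hmid : ∀ p, p ∈ E ⟨n / 2 - 1, by omega⟩ → p ∈ E ⟨n / 2, by omega⟩ →
      HasMultiplier f (E ⟨n / 2, by omega⟩) p (chainMultiplier B C n (n / 2 + 1))) :
    ∃ q, IsFixedChain f E B C q := by
  classical
  have hsub : ∀ i, E i ⊆ ⋃ i, E i := Set.subset_iUnion E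
  set D := B ^ 2 with hD
  have hD0 : D ≠ 0 := pow_ne_zero _ hB0
  -- The index is shifted so that `q₀ (i + 1)` is the node between curves `i` and `i + 1`; the value
  -- at `0` is irrelevant.
  obtain ⟨q₀, hq₀⟩ : ∃ q₀ : ℕ → X, ∀ i (hi : i + 1 < n),
      E ⟨i, by omega⟩ ∩ E ⟨i + 1, hi⟩ = {q₀ (i + 1)} ∧ tangentVectors (E ⟨i, by omega⟩) (q₀ (i + 1)) ∩
        tangentVectors (E ⟨i + 1, hi⟩) (q₀ (i + 1)) ⊆ {0} := by
    have : Nonempty X := by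
      obtain ⟨p, -⟩ := hE.exists_node (i := 0) (by omega)
      exact ⟨p⟩
    refine ⟨fun j => if hj : ∃ i, j = i + 1 ∧ i + 1 < n then
      (hE.exists_node hj.choose_spec.2).choose else Classical.arbitrary X, fun i hi => ?_⟩
    have hj : ∃ i', i + 1 = i' + 1 ∧ i' + 1 < n := ⟨i, rfl, hi⟩
    have hii : hj.choose = i := by have := hj.choose_spec.1; omega
    have := (hE.exists_node hj.choose_spec.2).choose_spec
    simp only [dif_pos hj]
    simp only [hii] at this ⊢
    exact this
  have hl : ∀ i (hi : i + 1 < n), q₀ (i + 1) ∈ E ⟨i, by omega⟩ := fun i hi =>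
    ((Set.ext_iff.1 (hq₀ i hi).1 _).2 rfl).1
  have hr : ∀ i (hi : i + 1 < n), q₀ (i + 1) ∈ E ⟨i + 1, hi⟩ := fun i hi =>
    ((Set.ext_iff.1 (hq₀ i hi).1 _).2 rfl).2
  have hfix : ∀ i, i + 1 < n → f (q₀ (i + 1)) = q₀ (i + 1) := fun i hi =>
    (Set.ext_iff.1 (hq₀ i hi).1 _).1 ⟨hfE _ (hl i hi), hfE _ (hr i hi)⟩
  have hne : ∀ i, i + 2 < n → q₀ (i + 1) ≠ q₀ (i + 2) := fun i hi h =>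
    Set.disjoint_left.1 (hE.disjoint_of_lt (i := ⟨i, by omega⟩) (j := ⟨i + 2, hi⟩)
      (by simp)) (hl i (by omega)) (by rw [h]; exact hr (i + 1) hi)
  have hnode : ∀ i (hi : i + 1 < n) l, HasMultiplier f (E ⟨i, by omega⟩) (q₀ (i + 1)) l →
      HasMultiplier f (E ⟨i + 1, hi⟩) (q₀ (i + 1)) (D / l) := fun i hi l hl' => by
    obtain ⟨l', hl0', hm⟩ := hf.exists_multiplier hη hD0 (hsub _) (hfE _) (hE.curve _) (hr i hi)
      (hfix i hi)
    have := hf.multiplier_mul_of_transversal hη (hsub _ (hr i hi)) (hfix i hi) (hq₀ i hi).2 hl' hm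
    have hl0 : l ≠ 0 := by rintro rfl; rw [zero_mul] at this; exact hD0 this.symm
    rwa [← this, mul_div_cancel_left₀ _ hl0]
  obtain ⟨l, hl0, hlm⟩ := hf.exists_multiplier hη hD0 (hsub _) (hfE _) (hE.curve _)
    (hl 0 (by omega)) (hfix 0 (by omega))
  have hmul : ∀ i (hi : i + 1 < n), HasMultiplier f (E ⟨i, by omega⟩) (q₀ (i + 1)) (l / D ^ i) ∧
      HasMultiplier f (E ⟨i + 1, hi⟩) (q₀ (i + 1)) (D ^ (i + 1) / l) := by
    intro i
    induction i with
    | zero =>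
      intro hi
      refine ⟨by simpa using hlm, ?_⟩
      simpa using hnode 0 hi l hlm
    | succ i ih =>
      intro hi
      have h1 := hf.hasMultiplier_inv hη hD0 (hsub _) (hfE _) (hE.curve _) (hr i (by omega))
        (hl (i + 1) hi) (hne i hi) (hfix i (by omega)) (hfix (i + 1) hi) (ih (by omega)).2
      rw [inv_div] at h1
      refine ⟨h1, ?_⟩
      have h2 := hnode (i + 1) hi _ h1
      rwa [div_div_eq_mul_div, ← pow_succ'] at h2
  have hcm : ∀ i, chainMultiplier B C n (i + 1) = D ^ i * chainMultiplier B C n 1 := by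
    intro i
    induction i with
    | zero => simp
    | succ i ih => rw [chainMultiplier_succ hB0, ih, ← hD, pow_succ' D i, mul_assoc]
  -- Comparing the propagated multiplier at the central node with `hmid` determines the unknown `l`.
  have hlinv : l⁻¹ = chainMultiplier B C n 1 := by
    obtain ⟨k, hk⟩ : ∃ k, n / 2 = k + 1 := ⟨n / 2 - 1, by omega⟩
    have hkn : k + 1 < n := by omega
    have h1 := (hmul k hkn).2
    have h2 := hmid (q₀ (k + 1)) (by simpa [hk] using hl k hkn) (by simpa [hk] using hr k hkn)
    simp only [hk] at h2
    have h3 := h1.unique (hE.curve _) (hr k hkn) h2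
    rw [hcm, div_eq_mul_inv] at h3
    exact mul_left_cancel₀ (pow_ne_zero _ hD0) h3
  have hmul' : ∀ i (hi : i + 1 < n),
      HasMultiplier f (E ⟨i + 1, hi⟩) (q₀ (i + 1)) (chainMultiplier B C n (i + 1 + 1)) :=
    fun i hi => by
      rw [hcm, ← hlinv, ← div_eq_mul_inv]
      exact (hmul i hi).2
  -- As `n ≥ 2`, an end curve is not the middle one, so its multiplier is not 1.
  obtain ⟨a, haE, hane, hfa⟩ := hf.exists_other_fixed hη hD0 (hsub _) (hfE _) (hE.curve _)
    (hl 0 (by omega)) (hfix 0 (by omega)) hlm (by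
      rintro rfl
      rw [inv_one] at hlinv
      have := (chainMultiplier_eq_one hC hB hlinv.symm).1
      omega)
  have ham := hf.hasMultiplier_inv hη hD0 (hsub _) (hfE _) (hE.curve _) (hl 0 (by omega)) haE
    hane.symm (hfix 0 (by omega)) hfa hlm
  rw [hlinv] at ham
  obtain ⟨N, rfl⟩ : ∃ N, n = N + 2 := ⟨n - 2, by omega⟩
  obtain ⟨b, hbE, hbne, hfb⟩ := hf.exists_other_fixed hη hD0 (hsub _) (hfE _) (hE.curve _)
    (hr N (by omega)) (hfix N (by omega)) (hmul' N (by omega)) (fun h => by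
      have := (chainMultiplier_eq_one hC hB h).1
      omega)
  let q : ℕ → X := fun i => if i = 0 then a else if i = N + 2 then b else q₀ i
  have hq0 : q 0 = a := rfl
  have hqN : q (N + 2) = b := by simp [q]
  have hq : ∀ i, i + 1 < N + 2 → q (i + 1) = q₀ (i + 1) := fun i hi => by
    simp only [q]
    rw [if_neg (by omega), if_neg (by omega)]
  refine ⟨q, fun i hi => ?_, fun i hi => ?_, fun i hi => ?_, fun i hi => ?_, fun i hi => ?_⟩
  · cases i with
    | zero => exact haE
    | succ i => rw [hq i hi]; exact hr i hi
  · rcases Nat.lt_succ_iff_lt_or_eq.1 hi with h | rfl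
    · rw [hq i (by omega)]; exact hl i (by omega)
    · rw [hqN]; exact hbE
  · rcases Nat.lt_succ_iff_lt_or_eq.1 hi with h | rfl
    · rw [hq i (by omega)]
      cases i with
      | zero => exact hane
      | succ i => rw [hq i (by omega)]; exact hne i (by omega)
    · rw [hqN, hq N (by omega)]
      exact hbne.symm
  · cases i with
    | zero => exact hfa
    | succ i =>
      rcases hi.lt_or_eq with h | h
      · rw [hq i h]; exact hfix i h
      · obtain rfl : i = N + 1 := by omega
        rw [hqN]; exact hfb
  · cases i with
    | zero => exact ham
    | succ i => rw [hq i hi]; exact hmul' i hi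

namespace IsFixedChain

/-- Consecutive points differ by assumption. Points two steps apart could coincide only in the node
between two neighbouring curves, and points further apart lie on disjoint curves. -/
theorem injOn (hq : IsFixedChain f E B C q) (hE : IsTypeA E) : Set.InjOn q (Set.Iic n) := by
  have key : ∀ i j, i < j → j ≤ n → q i ≠ q j := by
    intro i j hij hj h
    obtain ⟨j, rfl⟩ : ∃ j', j = j' + 1 := ⟨j - 1, by omega⟩
    have h1 := hq.left_mem i (by omega)
    have h2 := hq.right_mem j (by omega)
    rcases (Nat.lt_succ_iff.1 hij).eq_or_lt with rfl | hlt
    · exact hq.ne i (by omega) h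
    rcases (Nat.succ_le_of_lt hlt).eq_or_lt with he | hlt'
    · obtain rfl : i + 1 = j := he
      obtain ⟨p, hp, -⟩ := hE.exists_node (i := i) (by omega)
      have e1 := (Set.ext_iff.1 hp (q i)).1 ⟨h1, by rw [h]; exact h2⟩
      have e2 := (Set.ext_iff.1 hp (q (i + 1))).1
        ⟨hq.right_mem i (by omega), hq.left_mem (i + 1) (by omega)⟩
      exact hq.ne i (by omega) (e1.trans e2.symm)
    · exact Set.disjoint_left.1 (hE.disjoint_of_lt (i := ⟨i, by omega⟩) (j := ⟨j, by omega⟩) hlt')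
        h1 (by rw [h]; exact h2)
  intro i hi j hj h
  rcases lt_trichotomy i j with hij | hij | hij
  · exact absurd h (key i j hij hj)
  · exact hij
  · exact absurd h.symm (key j i hij hi)

theorem exists_mem (hq : IsFixedChain f E B C q) (hn : 1 ≤ n) {i : ℕ} (hi : i ≤ n) :
    ∃ j, q i ∈ E j := by
  rcases hi.lt_or_eq with h | rfl
  · exact ⟨_, hq.left_mem i h⟩
  · obtain ⟨k, rfl⟩ : ∃ k, i = k + 1 := ⟨i - 1, by omega⟩
    exact ⟨_, hq.right_mem k (by omega)⟩

theorem det_id_sub [T2Space X] (hq : IsFixedChain f E B C q) (hη : IsAreaField η) (hE : IsTypeA E)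
    (hn : 1 ≤ n) (hf : IsSelfMap f (⋃ i, E i) η (B ^ 2))
    (hfE : ∀ i, Set.MapsTo f (E i) (E i)) (hB0 : B ≠ 0) (hC : C ^ 2 = 1) {i : ℕ} (hi : i ≤ n) :
    (ContinuousLinearMap.id ℂ Plane - tangentMapAt f (q i)).det =
      (1 - chainMultiplier B C n (i + 1)) * (1 - B ^ 2 / chainMultiplier B C n (i + 1)) := by
  have hsub : ∀ i, E i ⊆ ⋃ i, E i := Set.subset_iUnion E
  have hc0 := chainMultiplier_ne_zero (n := n) hB0 hC
  have hD0 : B ^ 2 ≠ 0 := pow_ne_zero _ hB0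
  rcases hi.lt_or_eq with h | rfl
  · exact hf.det_id_sub_of_multiplier hη (hsub _ (hq.left_mem i h)) (hq.fixed i hi) (hc0 _)
      (hq.multiplier i h)
  -- The last point lies only on the last curve, with the inverse multiplier there. The formula
  -- survives because the two eigenvalues merely change roles.
  · obtain ⟨k, rfl⟩ : ∃ k, i = k + 1 := ⟨i - 1, by omega⟩
    have hk : k < k + 1 := by omega
    have hm := hf.hasMultiplier_inv hη hD0 (hsub _) (hfE _) (hE.curve _) (hq.left_mem k hk)
      (hq.right_mem k hk) (hq.ne k hk) (hq.fixed k hk.le) (hq.fixed (k + 1) le_rfl)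
      (hq.multiplier k hk)
    rw [hf.det_id_sub_of_multiplier hη (hsub _ (hq.right_mem k hk)) (hq.fixed _ le_rfl)
      (inv_ne_zero (hc0 _)) hm, chainMultiplier_succ hB0 (k + 1)]
    have := hc0 (k + 1)
    field_simp

theorem det_ne_zero [T2Space X] (hq : IsFixedChain f E B C q) (hη : IsAreaField η)
    (hE : IsTypeA E) (hn : 1 ≤ n) (hf : IsSelfMap f (⋃ i, E i) η (B ^ 2))
    (hfE : ∀ i, Set.MapsTo f (E i) (E i)) (hB0 : B ≠ 0) (hC : C ^ 2 = 1) {i : ℕ}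
    (hi : i ∈ isolatedIndices B C n) :
    (ContinuousLinearMap.id ℂ Plane - tangentMapAt f (q i)).det ≠ 0 := by
  obtain ⟨hin, h1, h2⟩ := mem_isolatedIndices.1 hi
  rw [hq.det_id_sub hη hE hn hf hfE hB0 hC (by omega)]
  refine mul_ne_zero (sub_ne_zero.2 h2.symm) (sub_ne_zero.2 fun h => h1 ?_)
  have hD0 : B ^ 2 ≠ 0 := pow_ne_zero _ hB0
  have hc0 := chainMultiplier_ne_zero (n := n) hB0 hC i
  rw [chainMultiplier_succ hB0] at h
  field_simp at h
  exact h

/-- A curve with multiplier 1 is pointwise fixed and carries no isolated fixed point; on any other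
curve the fixed points are just its two chain points. At the remaining indices `det (1 - Df)` is
nonzero, which gives isolation. -/
theorem isolatedFixedPoints_eq [T2Space X] (hq : IsFixedChain f E B C q) (hη : IsAreaField η)
    (hE : IsTypeA E) (hn : 1 ≤ n) (hf : IsSelfMap f (⋃ i, E i) η (B ^ 2))
    (hfE : ∀ i, Set.MapsTo f (E i) (E i)) (hB0 : B ≠ 0) (hC : C ^ 2 = 1)
    (hB : ∀ e : ℤ, B ^ e = 1 → e = 0) :
    isolatedFixedPoints f E = q '' (isolatedIndices B C n : Set ℕ) := by
  have hsub : ∀ i, E i ⊆ ⋃ i, E i := Set.subset_iUnion E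
  have hD0 : B ^ 2 ≠ 0 := pow_ne_zero _ hB0
  have hone : ∀ i (hi : i < n), chainMultiplier B C n (i + 1) = 1 → ∀ x ∈ E ⟨i, hi⟩, f x = x := by
    intro i hi h x hx
    have hm := hq.multiplier i hi
    rw [h] at hm
    exact hf.eq_self_of_multiplier_one hη hD0 (hsub _) (hfE _) (hE.curve _) (hq.left_mem i hi)
      (hq.right_mem i hi) (hq.ne i hi) (hq.fixed i hi.le) (hq.fixed _ hi) hm hx
  have hnot : ∀ i (hi : i < n), chainMultiplier B C n (i + 1) = 1 → ∀ x ∈ E ⟨i, hi⟩,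
      ¬ ∀ᶠ y in 𝓝[≠] x, f y ≠ y := fun i hi h x hx =>
    (hE.curve _).not_isolated (hone i hi h) hx
  have hiso : ∀ i, i ≤ n → (∀ᶠ y in 𝓝[≠] (q i), f y ≠ y) → i ∈ isolatedIndices B C n := by
    intro i hi hev
    refine mem_isolatedIndices.2 ⟨by omega, fun h => ?_, fun h => ?_⟩
    -- The relation `2 * i = n + 1` guarantees that the multiplier 1 belongs to an actual curve of
    -- the chain, not to a formal index `0` or `n + 1`.
    · have h2 := (chainMultiplier_eq_one hC hB h).1
      obtain ⟨k, rfl⟩ : ∃ k, i = k + 1 := ⟨i - 1, by omega⟩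
      exact hnot k (by omega) h _ (hq.right_mem k (by omega)) hev
    · have h2 := (chainMultiplier_eq_one hC hB h).1
      exact hnot i (by omega) h _ (hq.left_mem i (by omega)) hev
  ext x
  constructor
  · rintro ⟨hx, hfx, hev⟩
    obtain ⟨⟨i, hi⟩, hxi⟩ := Set.mem_iUnion.1 hx
    have h1 : chainMultiplier B C n (i + 1) ≠ 1 := fun h => hnot i hi h x hxi hev
    rcases hf.eq_or_eq_of_fixed hη hD0 (hsub _) (hfE _) (hE.curve _) (hq.left_mem i hi)
      (hq.right_mem i hi) (hq.ne i hi) (hq.fixed i hi.le) (hq.fixed _ hi) (hq.multiplier i hi) h1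
      hxi hfx with rfl | rfl
    · exact ⟨i, hiso i hi.le hev, rfl⟩
    · exact ⟨i + 1, hiso _ hi hev, rfl⟩
  · rintro ⟨i, hi, rfl⟩
    have hin : i ≤ n := Nat.lt_succ_iff.1 (mem_isolatedIndices.1 hi).1
    obtain ⟨j, hj⟩ := hq.exists_mem hn hin
    exact ⟨hsub j hj, hq.fixed i hin, eventually_ne_of_det_ne_zero (hf.smooth _ (hsub j hj))
      (hq.fixed i hin) (hq.det_ne_zero hη hE hn hf hfE hB0 hC hi)⟩

theorem fixedCurves_eq [T2Space X] (hq : IsFixedChain f E B C q) (hη : IsAreaField η)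
    (hE : IsTypeA E) (hf : IsSelfMap f (⋃ i, E i) η (B ^ 2))
    (hfE : ∀ i, Set.MapsTo f (E i) (E i)) (hB0 : B ≠ 0) :
    fixedCurves f E = {i : Fin n | chainMultiplier B C n (i + 1) = 1}.ncard := by
  have hsub : ∀ i, E i ⊆ ⋃ i, E i := Set.subset_iUnion E
  have hD0 : B ^ 2 ≠ 0 := pow_ne_zero _ hB0
  unfold fixedCurves
  congr 1
  ext i
  constructor
  · intro h
    exact (hq.multiplier i i.2).unique (hE.curve _) (hq.left_mem i i.2)
      (hasMultiplier_one_of_fixed (hE.curve _) (hq.left_mem i i.2) h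
        (hf.mdifferentiableAt (hsub _ (hq.left_mem i i.2))))
  · intro h x hx
    have hm := hq.multiplier i i.2
    rw [h] at hm
    exact hf.eq_self_of_multiplier_one hη hD0 (hsub _) (hfE _) (hE.curve _) (hq.left_mem i i.2)
      (hq.right_mem i i.2) (hq.ne i i.2) (hq.fixed i i.2.le) (hq.fixed _ i.2) hm hx

end IsFixedChain

end TypeA

end

/-! ### Nonvanishing of the twist number -/

section

/-- If the derivative vanished, `ψ - ψ z₀` would be a constant times the `n`-th power of a local
coordinate `h` with `n ≥ 2`. Points whose `h`-values differ by a primitive `n`-th root of unity then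
have equal images. -/
theorem deriv_ne_zero_of_injOn {ψ : ℂ → ℂ} {z₀ : ℂ} (hψ : AnalyticAt ℂ ψ z₀) {s : Set ℂ}
    (hs : s ∈ 𝓝 z₀) (hinj : Set.InjOn ψ s) : deriv ψ z₀ ≠ 0 := by
  intro hd
  have hF : AnalyticAt ℂ (fun z => ψ z - ψ z₀) z₀ := hψ.sub analyticAt_const
  have hnt : analyticOrderAt (fun z => ψ z - ψ z₀) z₀ ≠ ⊤ := by
    rw [Ne, analyticOrderAt_eq_top]
    intro h
    have h1 : ∀ᶠ z in 𝓝[≠] z₀, ψ z - ψ z₀ = 0 ∧ z ∈ s :=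
      nhdsWithin_le_nhds (h.and hs)
    obtain ⟨z, ⟨hz, hzs⟩, hne⟩ := (h1.and self_mem_nhdsWithin).exists
    exact hne (hinj hzs (mem_of_mem_nhds hs) (sub_eq_zero.1 hz))
  obtain ⟨g, hg, hg0, hev⟩ := hF.analyticOrderAt_ne_top.1 hnt
  set n := analyticOrderNatAt (fun z => ψ z - ψ z₀) z₀ with hn
  have hn0 : n ≠ 0 := by
    intro h0
    have := hev.self_of_nhds
    rw [h0] at this
    simp [hg0.symm] at this
  have hn1 : n ≠ 1 := by
    intro h1
    have hd1 : HasDerivAt (fun z => ψ z - ψ z₀) 0 z₀ := by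
      have := hψ.differentiableAt.hasDerivAt.sub_const (ψ z₀)
      rwa [hd] at this
    have hd2 : HasDerivAt (fun z => (z - z₀) * g z) (g z₀) z₀ := by
      have := ((hasDerivAt_id z₀).sub_const z₀).mul hg.differentiableAt.hasDerivAt
      simp only [id, sub_self, zero_mul, add_zero, one_mul] at this
      exact this
    refine hg0 (hd2.unique (hd1.congr_of_eventuallyEq ?_))
    filter_upwards [hev] with z hz
    rw [hz, h1, pow_one, smul_eq_mul]
  have hroot : AnalyticAt ℂ (fun z => (g z / g z₀) ^ ((n : ℂ)⁻¹)) z₀ :=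
    (hg.div analyticAt_const hg0).cpow analyticAt_const (by simp [div_self hg0])
  let h : ℂ → ℂ := fun z => (z - z₀) * (g z / g z₀) ^ ((n : ℂ)⁻¹)
  have hh : AnalyticAt ℂ h z₀ := (analyticAt_id.sub analyticAt_const).mul hroot
  have hh0 : h z₀ = 0 := by simp [h]
  have hhd : HasDerivAt h 1 z₀ := by
    have := ((hasDerivAt_id z₀).sub_const z₀).mul hroot.differentiableAt.hasDerivAt
    simp only [id, sub_self, zero_mul, add_zero, one_mul, div_self hg0, Complex.one_cpow] at this
    exact this
  have hstrict : HasStrictDerivAt h 1 z₀ := by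
    have := hh.hasStrictDerivAt
    rwa [hhd.deriv] at this
  have hmap := hstrict.map_nhds_eq one_ne_zero
  rw [hh0] at hmap
  have himg : h '' {z | z ∈ s ∧ ψ z - ψ z₀ = (z - z₀) ^ n • g z} ∈ 𝓝 (0 : ℂ) := by
    rw [← hmap]
    exact Filter.image_mem_map (Filter.inter_mem hs hev)
  have hpow : ∀ z, h z ^ n * g z₀ = (z - z₀) ^ n * g z := fun z => by
    simp only [h]
    rw [mul_pow, Complex.cpow_nat_inv_pow _ hn0]
    field_simp
  set ζ : ℂ := Complex.exp (2 * Real.pi * Complex.I / n)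
  have hζ : IsPrimitiveRoot ζ n := Complex.isPrimitiveRoot_exp n hn0
  have hζ1 : ζ ≠ 1 := hζ.ne_one (by omega)
  have hmulζ : Filter.Tendsto (fun t : ℂ => t * ζ) (𝓝 0) (𝓝 0) := by
    have : ContinuousAt (fun t : ℂ => t * ζ) 0 := by fun_prop
    simpa [ContinuousAt] using this
  have hex : ∀ᶠ t in 𝓝[≠] (0 : ℂ), t ∈ h '' {z | z ∈ s ∧ ψ z - ψ z₀ = (z - z₀) ^ n • g z} ∧
      t * ζ ∈ h '' {z | z ∈ s ∧ ψ z - ψ z₀ = (z - z₀) ^ n • g z} :=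
    nhdsWithin_le_nhds (Filter.Eventually.and himg (hmulζ.eventually himg))
  obtain ⟨t, ⟨⟨z₁, ⟨hz₁, e₁⟩, ht₁⟩, ⟨z₂, ⟨hz₂, e₂⟩, ht₂⟩⟩, ht0⟩ :=
    (hex.and self_mem_nhdsWithin).exists
  have heq : ψ z₁ = ψ z₂ := by
    rw [smul_eq_mul, ← hpow] at e₁ e₂
    rw [ht₁] at e₁
    rw [ht₂, mul_pow, hζ.pow_eq_one, mul_one] at e₂
    exact sub_left_injective (e₁.trans e₂.symm)
  rw [hinj hz₁ hz₂ heq, ht₂] at ht₁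
  exact hζ1 (mul_left_cancel₀ ht0 (by rw [ht₁, mul_one]))

variable {X : Type*} [TopologicalSpace X] [ChartedSpace Plane X] [T2Space X]

/-- In the parameters of the curves `f` is an injective holomorphic function of one variable. In
contrast to `IsSelfMap.tangentMapAt_ne_zero`, this makes no use of the twist number. -/
theorem IsParam.tangentMapAt_velocity_ne_zero {C C' : Set X} {u v u' v' : ℂ → X}
    (h : IsParam C u v) (h' : IsParam C' u' v') {f : X → X}
    (hf : ∀ p ∈ C, MDifferentiableAt 𝓘(ℂ, Plane) 𝓘(ℂ, Plane) f p) (hinj : Set.InjOn f C)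
    (hmaps : Set.MapsTo f C C') (h0 : f (v 0) = v' 0) :
    tangentMapAt f (v 0) (velocity v 0) ≠ 0 := by
  have hlift : ∀ s t, f (v s) = v' t → ∃ φ : ℂ → ℂ, φ s = t ∧ DifferentiableAt ℂ φ s ∧
      ∀ᶠ x in 𝓝 s, f (v x) = v' (φ x) := fun s t hst =>
    h'.swap.exists_lift (γ := fun x => f (v x))
      ((hf _ (h.right_mem s)).comp s (h.mdifferentiable_right s))
      (Filter.Eventually.of_forall fun x => hmaps (h.right_mem x)) hst
  obtain ⟨ψ, hψ0, hψd, hψ⟩ := hlift 0 0 h0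
  -- The lift is a priori differentiable only at `0`; lifts based at nearby points agree with `ψ`,
  -- which makes it analytic.
  have hd : ∀ᶠ x in 𝓝 0, DifferentiableAt ℂ ψ x := by
    filter_upwards [hψ.eventually_nhds] with x hx
    obtain ⟨φ, -, hφd, hφ⟩ := hlift x (ψ x) hx.self_of_nhds
    refine hφd.congr_of_eventuallyEq ?_
    filter_upwards [hx, hφ] with y hy hy'
    exact h'.swap.inj (hy.symm.trans hy')
  have han : AnalyticAt ℂ ψ 0 := Complex.analyticAt_iff_eventually_differentiableAt.2 hd
  have hne : deriv ψ 0 ≠ 0 := by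
    refine deriv_ne_zero_of_injOn han hψ fun x hx y hy hxy => ?_
    have hx' : f (v x) = v' (ψ x) := hx
    have hy' : f (v y) = v' (ψ y) := hy
    exact h.swap.inj (hinj (h.right_mem x) (h.right_mem y) (by rw [hx', hy', hxy]))
  rw [← velocity_comp_left (hf _ (h.right_mem 0)) (h.mdifferentiable_right 0),
    velocity_congr hψ, velocity_comp_right (h'.mdifferentiable_right _) hψd.hasDerivAt, hψ0]
  exact smul_ne_zero hne h'.velocity_right

theorem IsSelfMap.exists_tangent_image {f : X → X} {S C C' : Set X}
    {η : X → Plane →L[ℂ] Plane →L[ℂ] ℂ} {d : ℂ} {p : X} (hf : IsSelfMap f S η d) (hCS : C ⊆ S)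
    (hfC : Set.MapsTo f C C') (hC : IsSmoothRationalCurve C) (hC' : IsSmoothRationalCurve C')
    (hp : p ∈ C) : ∃ w, tangentMapAt f p w ∈ tangentVectors C' (f p) ∧ tangentMapAt f p w ≠ 0 := by
  obtain ⟨u, v, h⟩ := hC.exists_param
  obtain ⟨u, v, h, rfl⟩ := h.exists_right_eq hp
  obtain ⟨u', v', h'⟩ := hC'.exists_param
  obtain ⟨u', v', h', he⟩ := h'.exists_right_eq (hfC hp)
  exact ⟨velocity v 0, tangentMapAt_mem_tangentVectors (hf.smooth _ (hCS hp)) hfC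
    (h.swap.velocity_mem 0), h.tangentMapAt_velocity_ne_zero h'
      (fun _ hp => hf.mdifferentiableAt (hCS hp)) (hf.injOn.mono hCS) hfC he.symm⟩

/-- At a node the two tangent lines go to nonzero vectors along two transversal curves, on which `η`
cannot vanish; `d = 0` would force it to. -/
theorem IsSelfMap.twist_ne_zero {n : ℕ} {E : Fin n → Set X} (hE : IsTypeA E) (hn : 2 ≤ n)
    {f : X → X} {η : X → Plane →L[ℂ] Plane →L[ℂ] ℂ} {d : ℂ} (hη : IsAreaField η)
    (hf : IsSelfMap f (⋃ i, E i) η d)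
    {σ : SimpleGraph.pathGraph n ≃g SimpleGraph.pathGraph n}
    (hσ : ∀ i, Set.MapsTo f (E i) (E (σ i))) : d ≠ 0 := by
  rintro rfl
  have hsub : ∀ i, E i ⊆ ⋃ i, E i := Set.subset_iUnion E
  have hadj : (SimpleGraph.pathGraph n).Adj ⟨0, by omega⟩ ⟨1, by omega⟩ :=
    SimpleGraph.pathGraph_adj.2 (Or.inl rfl)
  obtain ⟨p, hp, -⟩ := hE.adjacent _ _ hadj
  obtain ⟨p', hp', htr⟩ := hE.adjacent _ _ (σ.map_adj_iff.2 hadj)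
  obtain ⟨h0, h1⟩ := (Set.ext_iff.1 hp p).2 rfl
  have hfp : f p = p' := (Set.ext_iff.1 hp' _).1 ⟨hσ _ h0, hσ _ h1⟩
  subst hfp
  obtain ⟨w, hw, hw0⟩ := hf.exists_tangent_image (hsub _) (hσ _) (hE.curve _) (hE.curve _) h0
  obtain ⟨w', hw', hw0'⟩ := hf.exists_tangent_image (hsub _) (hσ _) (hE.curve _) (hE.curve _) h1
  have := hf.pullback p (hsub _ h0) w w'
  rw [zero_mul] at this
  exact form_ne_zero (hη.alternating _) (hη.ne_zero _)
    (linearIndependent_of_transversal htr hw hw' hw0 hw0') this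

end

/-! ### Indices of the iterates -/

section

variable {X : Type*} [TopologicalSpace X] [ChartedSpace Plane X] {n : ℕ}
  {E : Fin n → Set X} {f : X → X} {η : X → Plane →L[ℂ] Plane →L[ℂ] ℂ} {B C : ℂ} {q : ℕ → X}

theorem zpow_eq_one_of_not_root_of_unity {d : ℂ} (hd : ∀ k : ℕ, 1 ≤ k → d ^ k ≠ 1) {e : ℤ}
    (h : d ^ e = 1) : e = 0 := by
  by_contra he
  refine hd e.natAbs (by omega) ?_
  rcases Int.natAbs_eq e with h' | h'
  · rw [h', zpow_natCast] at h
    exact h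
  · rw [h', zpow_neg, zpow_natCast, inv_eq_one] at h
    exact h

theorem mapsTo_iterate_two_mul {X : Type*} {n : ℕ} {E : Fin n → Set X} {f : X → X}
    (hfE : ∀ i : Fin n, Set.MapsTo f (E i) (E i.rev)) (j : ℕ)
    (i : Fin n) : Set.MapsTo f^[2 * j] (E i) (E i) := by
  rw [Function.iterate_mul]
  refine Set.MapsTo.iterate (fun x hx => ?_) j
  have := hfE _ (hfE i hx)
  rwa [Fin.rev_rev] at this

theorem isSelfMap_of_isAutomorphismNear [IsManifold 𝓘(ℂ, Plane) ω X]
    {θ : ∀ x : X, TangentSpace 𝓘(ℂ, Plane) x →L[ℂ] TangentSpace 𝓘(ℂ, Plane) x →L[ℂ] ℂ} {S : Set X}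
    {d : ℂ} (hf : IsAutomorphismNear f S θ d) :
    IsSelfMap f S (fun x => θ x) d := by
  obtain ⟨himg, V, hV, hSV, hinj, hsm, hpb⟩ := hf
  exact ⟨fun x hx => himg ▸ Set.mem_image_of_mem f hx, hinj.mono hSV,
    fun p hp => (hsm p (hSV hp)).contMDiffAt (hV.mem_nhds (hSV hp)),
    fun p hp v w => hpb p (hSV hp) v w⟩

theorem exists_swapped_nodes (hE : IsTypeA E) (hfE : ∀ i : Fin n, Set.MapsTo f (E i) (E i.rev))
    {k : ℕ} (hk : 1 ≤ k) (hn : n = 2 * k + 1) :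
    ∃ p q, E ⟨k - 1, by omega⟩ ∩ E ⟨k, by omega⟩ = {p} ∧ q ∈ E ⟨k, by omega⟩ ∧ p ≠ q ∧
      f p = q ∧ f q = p := by
  obtain ⟨k, rfl⟩ : ∃ j, k = j + 1 := ⟨k - 1, by omega⟩
  obtain ⟨p, hp, -⟩ := hE.exists_node (i := k) (by omega)
  obtain ⟨q, hq, -⟩ := hE.exists_node (i := k + 1) (by omega)
  have hp' := (Set.ext_iff.1 hp p).2 rfl
  have hq' := (Set.ext_iff.1 hq q).2 rfl
  have r0 : (⟨k, by omega⟩ : Fin n).rev = ⟨k + 1 + 1, by omega⟩ := by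
    ext; simp [Fin.val_rev]; omega
  have r1 : (⟨k + 1, by omega⟩ : Fin n).rev = ⟨k + 1, by omega⟩ := by
    ext; simp [Fin.val_rev]; omega
  have r2 : (⟨k + 1 + 1, by omega⟩ : Fin n).rev = ⟨k, by omega⟩ := by
    rw [← r0, Fin.rev_rev]
  have m0 := hfE ⟨k, by omega⟩
  have m1 := hfE ⟨k + 1, by omega⟩
  have m2 := hfE ⟨k + 1 + 1, by omega⟩
  rw [r0] at m0
  rw [r1] at m1
  rw [r2] at m2
  refine ⟨p, q, hp, hq'.1, ?_, (Set.ext_iff.1 hq _).1 ⟨m1 hp'.2, m0 hp'.1⟩,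
    (Set.ext_iff.1 hp _).1 ⟨m2 hq'.2, m1 hq'.1⟩⟩
  rintro rfl
  exact Set.disjoint_left.1 (hE.disjoint_of_lt (i := ⟨k, by omega⟩) (j := ⟨k + 1 + 1, by omega⟩)
    (by simp)) hp'.1 hq'.2

theorem IsFixedChain.injOn_isolatedIndices (hq : IsFixedChain f E B C q) (hE : IsTypeA E) :
    Set.InjOn q (isolatedIndices B C n : Set ℕ) :=
  (hq.injOn hE).mono fun _ hi => Nat.lt_succ_iff.1 (mem_isolatedIndices.1 hi).1

variable [T2Space X]

namespace IsFixedChain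

theorem mem_iUnion_of_isolatedIndices (hq : IsFixedChain f E B C q) (hη : IsAreaField η)
    (hE : IsTypeA E) (hn : 1 ≤ n) (hf : IsSelfMap f (⋃ i, E i) η (B ^ 2))
    (hfE : ∀ i, Set.MapsTo f (E i) (E i)) (hB0 : B ≠ 0) (hC : C ^ 2 = 1)
    (hB : ∀ e : ℤ, B ^ e = 1 → e = 0)
    {i : ℕ} (hi : i ∈ isolatedIndices B C n) :
    q i ∈ ⋃ j, E j := by
  have : q i ∈ isolatedFixedPoints f E := by
    rw [hq.isolatedFixedPoints_eq hη hE hn hf hfE hB0 hC hB]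
    exact ⟨i, hi, rfl⟩
  exact this.1

theorem muE_eq (hq : IsFixedChain f E B C q) (hη : IsAreaField η)
    (hE : IsTypeA E) (hn : 1 ≤ n) (hf : IsSelfMap f (⋃ i, E i) η (B ^ 2))
    (hfE : ∀ i, Set.MapsTo f (E i) (E i)) (hB0 : B ≠ 0) (hC : C ^ 2 = 1)
    (hB : ∀ e : ℤ, B ^ e = 1 → e = 0) :
    muE f E = ((isolatedIndices B C n).card : ℕ∞) +
    2 * (({i : Fin n | chainMultiplier B C n (i + 1) = 1}.ncard : ℕ) : ℕ∞) := by
  rw [muE, hq.fixedCurves_eq hη hE hf hfE hB0,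
    hq.isolatedFixedPoints_eq hη hE hn hf hfE hB0 hC hB,
    finsum_mem_image (hq.injOn_isolatedIndices hE), finsum_mem_coe_finset,
    Finset.sum_congr rfl fun i hi => ?_, Finset.sum_const, nsmul_one]
  exact mu_eq_one (hf.smooth _ (hq.mem_iUnion_of_isolatedIndices hη hE hn hf hfE hB0 hC hB hi))
    (hq.fixed i (Nat.lt_succ_iff.1 (mem_isolatedIndices.1 hi).1))
    (hq.det_ne_zero hη hE hn hf hfE hB0 hC hi)

theorem nuHatE_eq (hq : IsFixedChain f E B C q) (hη : IsAreaField η)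
    (hE : IsTypeA E) (hn : 1 ≤ n) (hf : IsSelfMap f (⋃ i, E i) η (B ^ 2))
    (hfE : ∀ i, Set.MapsTo f (E i) (E i)) (hB0 : B ≠ 0) (hC : C ^ 2 = 1)
    (hB : ∀ e : ℤ, B ^ e = 1 → e = 0) :
    nuHatE f E B = ∑ i ∈ isolatedIndices B C n, indexTerm B C n i +
    (({i : Fin n | chainMultiplier B C n (i + 1) = 1}.ncard : ℕ) : ℂ) *
      (B * ((B ^ 2 + 1) / (B ^ 2 - 1) ^ 2)) := by
  rw [nuHatE, hq.fixedCurves_eq hη hE hf hfE hB0,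
    hq.isolatedFixedPoints_eq hη hE hn hf hfE hB0 hC hB,
    finsum_mem_image (hq.injOn_isolatedIndices hE), finsum_mem_coe_finset,
    Finset.sum_congr rfl fun i hi => ?_]
  have hin : i ≤ n := Nat.lt_succ_iff.1 (mem_isolatedIndices.1 hi).1
  rw [nu_eq_inv_det
    (hf.smooth _ (hq.mem_iUnion_of_isolatedIndices hη hE hn hf hfE hB0 hC hB hi))
    (hq.fixed i hin) (hq.det_ne_zero hη hE hn hf hfE hB0 hC hi),
    hq.det_id_sub hη hE hn hf hfE hB0 hC hin]
  rfl

theorem indices_of_even (hq : IsFixedChain f E B C q) (hη : IsAreaField η)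
    (hE : IsTypeA E) (hn : 1 ≤ n) (hf : IsSelfMap f (⋃ i, E i) η (B ^ 2))
    (hfE : ∀ i, Set.MapsTo f (E i) (E i)) (hB0 : B ≠ 0) (hC : C ^ 2 = 1)
    (hB : ∀ e : ℤ, B ^ e = 1 → e = 0)
    (hn2 : Even n) (hB2 : B ^ 2 ≠ 1) (hY : C * B ^ (n + 1) ≠ 1) :
    muE f E = (n : ℕ∞) + 1 ∧
      nuHatE f E B = (1 + C * B ^ (n + 1)) / ((C * B ^ (n + 1) - 1) * (B - B⁻¹)) := by
  have hempty : {i : Fin n | chainMultiplier B C n (i + 1) = 1} = ∅ := by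
    ext i
    refine iff_of_false (fun h => ?_) (Set.notMem_empty i)
    have := (chainMultiplier_eq_one hC hB h).1
    obtain ⟨k, rfl⟩ := hn2
    omega
  rw [hq.muE_eq hη hE hn hf hfE hB0 hC hB, hq.nuHatE_eq hη hE hn hf hfE hB0 hC hB, hempty,
    Set.ncard_empty, sum_indexTerm_of_even hB0 hC hB hn2 hB2 hY,
    isolatedIndices_of_even hC hB hn2]
  simp

theorem indices_of_odd (hq : IsFixedChain f E B C q) (hη : IsAreaField η)
    (hE : IsTypeA E) (hn : 1 ≤ n) (hf : IsSelfMap f (⋃ i, E i) η (B ^ 2))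
    (hfE : ∀ i, Set.MapsTo f (E i) (E i)) (hB0 : B ≠ 0) (hC : C ^ 2 = 1)
    (hB : ∀ e : ℤ, B ^ e = 1 → e = 0)
    (hn2 : Odd n) (hC1 : C = 1) (hB2 : B ^ 2 ≠ 1) (hY : C * B ^ (n + 1) ≠ 1) :
    muE f E = (n : ℕ∞) + 1 ∧
      nuHatE f E B = (1 + C * B ^ (n + 1)) / ((C * B ^ (n + 1) - 1) * (B - B⁻¹)) := by
  obtain ⟨k, rfl⟩ := hn2
  subst hC1
  have hsingle : {i : Fin (2 * k + 1) | chainMultiplier B 1 (2 * k + 1) (i + 1) = 1} =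
      {⟨k, by omega⟩} := by
    ext i
    constructor
    · intro h
      have := (chainMultiplier_eq_one hC hB h).1
      exact Fin.ext (by simp; omega)
    · rintro rfl
      exact chainMultiplier_mid
  have hsub : ({k, k + 1} : Finset ℕ) ⊆ Finset.range (2 * k + 1 + 1) := by
    intro i hi
    simp only [Finset.mem_insert, Finset.mem_singleton] at hi
    rw [Finset.mem_range]
    omega
  rw [hq.muE_eq hη hE hn hf hfE hB0 hC hB, hq.nuHatE_eq hη hE hn hf hfE hB0 hC hB, hsingle,
    Set.ncard_singleton, Nat.cast_one, Nat.cast_one, one_mul, sum_indexTerm_of_odd hB0 hB hB2 hY]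
  refine ⟨?_, rfl⟩
  -- The fixed curve, counted twice, makes up for the two points removed from the `n + 1`.
  rw [isolatedIndices_of_odd hB, Finset.card_sdiff_of_subset hsub, Finset.card_range,
    Finset.card_pair (by omega)]
  norm_cast

end IsFixedChain

/-- The central node is the only fixed point: a fixed point on a curve also lies on the mirror
curve, which is disjoint from it except for the two central curves. -/
theorem indices_of_swap_of_even (hη : IsAreaField η) (hE : IsTypeA E) {d : ℂ} (hn : 2 ≤ n)
    (hf : IsSelfMap f (⋃ i, E i) η d) (hfE : ∀ i : Fin n, Set.MapsTo f (E i) (E i.rev))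
    (hd0 : d ≠ 0) (hd1 : 1 + d ≠ 0) (hn2 : Even n) (b : ℂ) :
    (isolatedFixedPoints f E).Finite ∧ muE f E = 1 ∧ nuHatE f E b = b * (1 + d)⁻¹ := by
  have hsub : ∀ i, E i ⊆ ⋃ i, E i := Set.subset_iUnion E
  obtain ⟨k, hk⟩ := hn2
  obtain ⟨p, hp, htr⟩ := hE.exists_node (i := k - 1) (by omega)
  have hk1 : k - 1 + 1 < n := by omega
  set i₀ : Fin n := ⟨k - 1, by omega⟩ with hi₀
  set i₁ : Fin n := ⟨k - 1 + 1, hk1⟩ with hi₁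
  have hrev₀ : i₀.rev = i₁ := by ext; simp [hi₀, hi₁, Fin.val_rev]; omega
  have hrev₁ : i₁.rev = i₀ := by rw [← hrev₀, Fin.rev_rev]
  have h01 : Set.MapsTo f (E i₀) (E i₁) := hrev₀ ▸ hfE i₀
  have h10 : Set.MapsTo f (E i₁) (E i₀) := hrev₁ ▸ hfE i₁
  obtain ⟨hp0, hp1⟩ := (Set.ext_iff.1 hp p).2 rfl
  have hfp : f p = p := (Set.ext_iff.1 hp _).1 ⟨h10 hp1, h01 hp0⟩
  have hdet := hf.det_id_sub_of_swap hη hd0 (hsub _ hp0) hfp (hE.curve _) (hE.curve _) hp0 hp1 h01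
    h10 htr
  have hdet0 : (ContinuousLinearMap.id ℂ Plane - tangentMapAt f p).det ≠ 0 := by rwa [hdet]
  have huniq : ∀ i, ∀ x ∈ E i, f x = x → x = p := by
    intro i x hx hfx
    have hx' : x ∈ E i.rev := by rw [← hfx]; exact hfE i hx
    rcases lt_trichotomy (i : ℕ) (k - 1) with h | h | h
    · exact (Set.disjoint_left.1 (hE.disjoint_of_lt (i := i) (j := i.rev)
        (by rw [Fin.val_rev]; omega)) hx hx').elim
    · obtain rfl : i = i₀ := Fin.ext h
      exact (Set.ext_iff.1 hp x).1 ⟨hx, hrev₀ ▸ hx'⟩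
    · rcases eq_or_ne (i : ℕ) (k - 1 + 1) with h' | h'
      · obtain rfl : i = i₁ := Fin.ext h'
        exact (Set.ext_iff.1 hp x).1 ⟨hrev₁ ▸ hx', hx⟩
      · exact (Set.disjoint_left.1 (hE.disjoint_of_lt (i := i.rev) (j := i)
          (by rw [Fin.val_rev]; omega)) hx' hx).elim
  have hiso : isolatedFixedPoints f E = {p} := by
    ext x
    constructor
    · rintro ⟨hx, hfx, -⟩
      obtain ⟨i, hi⟩ := Set.mem_iUnion.1 hx
      exact huniq i x hi hfx
    · rintro rfl
      exact ⟨hsub _ hp0, hfp, eventually_ne_of_det_ne_zero (hf.smooth _ (hsub _ hp0)) hfp hdet0⟩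
  have hN : fixedCurves f E = 0 := by
    unfold fixedCurves
    rw [Set.ncard_eq_zero]
    refine Set.eq_empty_iff_forall_notMem.2 fun i hi => (hE.curve i).infinite ?_
    exact (Set.finite_singleton p).subset fun x hx => huniq i x hx (hi x hx)
  refine ⟨by rw [hiso]; exact Set.finite_singleton p, ?_, ?_⟩
  · rw [muE, hN, hiso, finsum_mem_singleton, mu_eq_one (hf.smooth _ (hsub _ hp0)) hfp hdet0]
    simp
  · rw [nuHatE, hN, hiso, finsum_mem_singleton,
      nu_eq_inv_det (hf.smooth _ (hsub _ hp0)) hfp hdet0, hdet]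
    simp

/-- Only the central curve meets its mirror image. The map exchanges its two nodes, so it has
exactly two fixed points there, with eigenvalues `-1` and `-d`. -/
theorem indices_of_swap_of_odd (hη : IsAreaField η) (hE : IsTypeA E) {d : ℂ} (hn : 2 ≤ n)
    (hf : IsSelfMap f (⋃ i, E i) η d) (hfE : ∀ i : Fin n, Set.MapsTo f (E i) (E i.rev))
    (hd0 : d ≠ 0) (hd1 : 1 + d ≠ 0) (hn2 : Odd n) (b : ℂ) :
    (isolatedFixedPoints f E).Finite ∧ muE f E = 2 ∧ nuHatE f E b = b * (1 + d)⁻¹ := by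
  have hsub : ∀ i, E i ⊆ ⋃ i, E i := Set.subset_iUnion E
  obtain ⟨k, hk⟩ := hn2
  obtain ⟨p, q, hp, hq, hpq, hfp, hfq⟩ := exists_swapped_nodes hE hfE (k := k) (by omega) hk
  set i₀ : Fin n := ⟨k, by omega⟩ with hi₀
  have hrev : i₀.rev = i₀ := by ext; simp [hi₀, Fin.val_rev]; omega
  have hm : Set.MapsTo f (E i₀) (E i₀) := by have := hfE i₀; rwa [hrev] at this
  obtain ⟨x, hx, y, hy, hxy, hfix, hmx, hmy⟩ := hf.exists_fixed_of_swap hη hd0 (hsub _) hm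
    (hE.curve _) ((Set.ext_iff.1 hp p).2 rfl).2 hq hpq hfp hfq
  have hdet : ∀ z ∈ E i₀, f z = z → HasMultiplier f (E i₀) z (-1) →
      (ContinuousLinearMap.id ℂ Plane - tangentMapAt f z).det = 2 * (1 + d) := by
    intro z hz hfz hmz
    rw [hf.det_id_sub_of_multiplier hη (hsub _ hz) hfz (neg_ne_zero.2 one_ne_zero) hmz]
    ring
  have h2d : 2 * (1 + d) ≠ 0 := mul_ne_zero two_ne_zero hd1
  have hfx : f x = x := (hfix x hx).2 (Or.inl rfl)
  have hfy : f y = y := (hfix y hy).2 (Or.inr rfl)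
  have hdx := hdet x hx hfx hmx
  have hdy := hdet y hy hfy hmy
  have hdx0 : (ContinuousLinearMap.id ℂ Plane - tangentMapAt f x).det ≠ 0 := by rwa [hdx]
  have hdy0 : (ContinuousLinearMap.id ℂ Plane - tangentMapAt f y).det ≠ 0 := by rwa [hdy]
  have huniq : ∀ i, ∀ z ∈ E i, f z = z → z = x ∨ z = y := by
    intro i z hz hfz
    have hz' : z ∈ E i.rev := by rw [← hfz]; exact hfE i hz
    rcases lt_trichotomy (i : ℕ) k with h | h | h
    · exact (Set.disjoint_left.1 (hE.disjoint_of_lt (i := i) (j := i.rev)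
        (by rw [Fin.val_rev]; omega)) hz hz').elim
    · obtain rfl : i = i₀ := Fin.ext h
      exact (hfix z hz).1 hfz
    · exact (Set.disjoint_left.1 (hE.disjoint_of_lt (i := i.rev) (j := i)
        (by rw [Fin.val_rev]; omega)) hz' hz).elim
  have hiso : isolatedFixedPoints f E = {x, y} := by
    ext z
    constructor
    · rintro ⟨hz, hfz, -⟩
      obtain ⟨i, hi⟩ := Set.mem_iUnion.1 hz
      exact huniq i z hi hfz
    · rintro (rfl | rfl)
      · exact ⟨hsub _ hx, hfx, eventually_ne_of_det_ne_zero (hf.smooth _ (hsub _ hx)) hfx hdx0⟩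
      · exact ⟨hsub _ hy, hfy, eventually_ne_of_det_ne_zero (hf.smooth _ (hsub _ hy)) hfy hdy0⟩
  have hfin : ({x, y} : Set X).Finite := (Set.finite_singleton y).insert x
  have hN : fixedCurves f E = 0 := by
    unfold fixedCurves
    rw [Set.ncard_eq_zero]
    refine Set.eq_empty_iff_forall_notMem.2 fun i hi => (hE.curve i).infinite ?_
    exact hfin.subset fun z hz => huniq i z hz (hi z hz)
  refine ⟨by rwa [hiso], ?_, ?_⟩
  · rw [muE, hN, hiso, finsum_mem_pair hxy, mu_eq_one (hf.smooth _ (hsub _ hx)) hfx hdx0,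
      mu_eq_one (hf.smooth _ (hsub _ hy)) hfy hdy0, one_add_one_eq_two]
    simp
  · rw [nuHatE, hN, hiso, finsum_mem_pair hxy, nu_eq_inv_det (hf.smooth _ (hsub _ hx)) hfx hdx0,
      nu_eq_inv_det (hf.smooth _ (hsub _ hy)) hfy hdy0, hdx, hdy, Nat.cast_zero, zero_mul, add_zero]
    field_simp
    ring

/-- This is the source of the sign `(-1) ^ (j * (n + 1))`. For `n` even, `f ∘ f` has multiplier `-d`
at the central node and its `j`-th iterate has `(-1) ^ j * b ^ (2 * j)`; for `n` odd, `f ∘ f` is the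
identity on the central curve. -/
theorem hasMultiplier_iterate_middle (hη : IsAreaField η) (hE : IsTypeA E) {d b : ℂ} (hn : 2 ≤ n)
    (hf : IsSelfMap f (⋃ i, E i) η d) (hfE : ∀ i : Fin n, Set.MapsTo f (E i) (E i.rev))
    (hd0 : d ≠ 0) (hb : b ^ 2 = d) (j : ℕ) {p : X} (hp : p ∈ E ⟨n / 2 - 1, by omega⟩)
    (hp' : p ∈ E ⟨n / 2, by omega⟩) :
    HasMultiplier f^[2 * j] (E ⟨n / 2, by omega⟩) p
      (chainMultiplier (b ^ (2 * j)) ((-1) ^ (j * (n + 1))) n (n / 2 + 1)) := by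
  have hsub : ∀ i, E i ⊆ ⋃ i, E i := Set.subset_iUnion E
  rcases Nat.even_or_odd' n with ⟨k, hk | hk⟩
  · obtain ⟨l, rfl⟩ : ∃ l, k = l + 1 := ⟨k - 1, by omega⟩
    have hn2 : n / 2 = l + 1 := by omega
    simp only [hn2, Nat.add_sub_cancel] at hp hp' ⊢
    obtain ⟨q, hq, htr⟩ := hE.exists_node (i := l) (by omega)
    obtain rfl : p = q := (Set.ext_iff.1 hq p).1 ⟨hp, hp'⟩
    have r0 : (⟨l, by omega⟩ : Fin n).rev = ⟨l + 1, by omega⟩ := by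
      ext; simp [Fin.val_rev]; omega
    have r1 : (⟨l + 1, by omega⟩ : Fin n).rev = ⟨l, by omega⟩ := by
      rw [← r0, Fin.rev_rev]
    have m0 := hfE ⟨l, by omega⟩
    have m1 := hfE ⟨l + 1, by omega⟩
    rw [r0] at m0
    rw [r1] at m1
    have hfp : f p = p := (Set.ext_iff.1 hq _).1 ⟨m1 hp', m0 hp⟩
    have h1 := hf.hasMultiplier_sq_of_swap hη (hsub _ hp) hfp (hE.curve _) (hE.curve _) hp' hp m1
      m0 (by rwa [Set.inter_comm])
    have h2 := h1.iterate (hf.comp hf) (hsub _ hp) (by simp [hfp]) j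
    rw [Function.iterate_mul, show f^[2] = f ∘ f from rfl]
    convert h2 using 1
    unfold chainMultiplier
    -- For even `n` the multiplier just after the centre is `C * B` with exponent exactly 1.
    have he : (2 * (l + 1 + 1 : ℕ) - n - 1 : ℤ) = 1 := by push_cast; omega
    have hpar : (-1 : ℂ) ^ (j * (n + 1)) = (-1) ^ j := by
      rw [mul_comm, pow_mul]
      congr 1
      exact Odd.neg_one_pow ⟨l + 1, by omega⟩
    rw [he, zpow_one, hpar, pow_mul, hb, neg_pow d]
  · have hn2 : n / 2 = k := by omega
    simp only [hn2] at hp hp' ⊢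
    obtain ⟨p₁, q, hp₁, hq, hpq, hfp, hfq⟩ := exists_swapped_nodes hE hfE (k := k) (by omega) hk
    obtain rfl : p = p₁ := (Set.ext_iff.1 hp₁ p).1 ⟨hp, hp'⟩
    have hrev : (⟨k, by omega⟩ : Fin n).rev = ⟨k, by omega⟩ := by
      ext; simp [Fin.val_rev]; omega
    have hm := hfE ⟨k, by omega⟩
    rw [hrev] at hm
    have hinv : ∀ x ∈ E ⟨k, by omega⟩, f^[2 * j] x = x := fun x hx => by
      rw [Function.iterate_mul]
      exact Function.iterate_fixed (hf.involutive_of_swap hη hd0 (hsub _) hm (hE.curve _) hp' hq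
        hpq hfp hfq hx) j
    have h1 := hasMultiplier_one_of_fixed (hE.curve _) hp' hinv
      ((hf.iterate _).mdifferentiableAt (hsub _ hp'))
    convert h1 using 1
    have hpar : (-1 : ℂ) ^ (j * (n + 1)) = 1 := Even.neg_one_pow (by
      rw [hk]; exact ⟨j * (k + 1), by ring⟩)
    rw [hpar, hk]
    exact chainMultiplier_mid

end

end TypeAComponent

end

/-! ### The main theorem -/

open TypeAComponent in
theorem proposition6p9 {X : Type*} [TopologicalSpace X] [T2Space X]
    [ChartedSpace TypeAComponent.Plane X] [IsManifold 𝓘(ℂ, TypeAComponent.Plane) ω X]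
    (η : ∀ x : X, TangentSpace 𝓘(ℂ, TypeAComponent.Plane) x →L[ℂ]
      TangentSpace 𝓘(ℂ, TypeAComponent.Plane) x →L[ℂ] ℂ)
    (hη : TypeAComponent.IsHolomorphicAreaForm η)
    (n : ℕ) (hn : 2 ≤ n) (E : Fin n → Set X) (hE : TypeAComponent.IsTypeA E)
    (f : X → X) (δ : ℂ) (hf : TypeAComponent.IsAutomorphismNear f (⋃ i, E i) η δ)
    (hδ : ∀ k : ℕ, 1 ≤ k → δ ^ k ≠ 1)
    (hsymm : TypeAComponent.HasReflectionalSymmetry f E)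
    (β : ℂ) (hβ : β ^ 2 = δ) (m : ℕ) (hm : 1 ≤ m) :
    (TypeAComponent.isolatedFixedPoints f^[m] E).Finite ∧
    (Odd m → Even n → TypeAComponent.muE f^[m] E = 1) ∧
    (Odd m → Odd n → TypeAComponent.muE f^[m] E = 2) ∧
    (Even m → TypeAComponent.muE f^[m] E = (n : ℕ∞) + 1) ∧
    (Odd m →
      Polynomial.aeval (β + β⁻¹) (TypeAComponent.H m) ≠ 0 ∧
      TypeAComponent.nuHatE f^[m] E (β ^ m) =
        1 / Polynomial.aeval (β + β⁻¹) (TypeAComponent.H m)) ∧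
    (Even m →
      Polynomial.aeval (β + β⁻¹) (TypeAComponent.H (m * (n + 1))) -
        2 * (-1 : ℂ) ^ (m / 2 * (n + 1)) ≠ 0 ∧
      TypeAComponent.nuHatE f^[m] E (β ^ m) =
        Polynomial.aeval (Polynomial.aeval (β + β⁻¹) (TypeAComponent.H m)) (TypeAComponent.K n) /
          (Polynomial.aeval (β + β⁻¹) (TypeAComponent.H (m * (n + 1))) -
            2 * (-1 : ℂ) ^ (m / 2 * (n + 1)))) := by
  obtain ⟨σ, hσ, hord⟩ := hsymm
  have hfE : ∀ i : Fin n, Set.MapsTo f (E i) (E i.rev) := fun i x hx => by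
    rw [← pathGraph_aut_apply_eq_rev σ hord i, ← hσ i]
    exact Set.mem_image_of_mem f hx
  have hη' : IsAreaField (fun x => η x) := ⟨hη.alternating, hη.ne_zero⟩
  have hf' := isSelfMap_of_isAutomorphismNear hf
  have hδ0 : δ ≠ 0 := hf'.twist_ne_zero hE hn hη' (σ := σ) fun i x hx => by
    rw [← hσ i]; exact Set.mem_image_of_mem f hx
  have hβ0 : β ≠ 0 := by rintro rfl; simp at hβ; exact hδ0 hβ.symm
  set B := β ^ m with hBdef
  have hB0 : B ≠ 0 := pow_ne_zero _ hβ0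
  have hB2 : B ^ 2 = δ ^ m := by rw [hBdef, ← pow_mul, mul_comm, pow_mul, hβ]
  have hB : ∀ e : ℤ, B ^ e = 1 → e = 0 := fun e he => by
    have h1 : δ ^ ((m : ℤ) * e) = 1 := by
      rw [zpow_mul, zpow_natCast, ← hB2, ← zpow_natCast, ← zpow_mul, mul_comm, zpow_mul, he,
        one_zpow]
    have := zpow_eq_one_of_not_root_of_unity hδ h1
    rcases mul_eq_zero.1 this with h | h
    · omega
    · exact h
  have hpow : ∀ k : ℕ, k ≠ 0 → B ^ k ≠ 1 := fun k hk h => hk (by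
    have := hB k (by rwa [zpow_natCast])
    exact_mod_cast this)
  have hHm : Polynomial.aeval (β + β⁻¹) (H m) = B + B⁻¹ := by
    rw [aeval_H β hβ0, inv_pow]
  have hfm := hf'.iterate m
  rcases Nat.even_or_odd' m with ⟨j, hj | hj⟩
  · have hmE : Even m := ⟨j, by omega⟩
    have hmO : ¬ Odd m := Nat.not_odd_iff_even.2 hmE
    have hj2 : m / 2 = j := by omega
    have hfmE : ∀ i, Set.MapsTo f^[m] (E i) (E i) := fun i => by
      rw [hj]; exact mapsTo_iterate_two_mul hfE j i
    rw [← hB2] at hfm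
    set C : ℂ := (-1) ^ (j * (n + 1)) with hCdef
    have hC : C ^ 2 = 1 := by rw [hCdef, ← pow_mul, mul_comm, pow_mul]; simp
    obtain ⟨q, hq⟩ := exists_isFixedChain hη' hE hn hfm hfmE hB0 hC hB (fun p hp hp' => by
      have := hasMultiplier_iterate_middle hη' hE hn hf' hfE hδ0 hβ j hp hp'
      rwa [← hj] at this)
    have hn1 : 1 ≤ n := by omega
    -- Equality would make `B` a root of unity after squaring away the sign `C`.
    have hY : C * B ^ (n + 1) ≠ 1 := fun h => by
      refine hpow ((n + 1) * 2) (by omega) ?_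
      calc B ^ ((n + 1) * 2) = C ^ 2 * B ^ ((n + 1) * 2) := by rw [hC, one_mul]
        _ = 1 := by rw [pow_mul, ← mul_pow, h, one_pow]
    have hB21 : B ^ 2 ≠ 1 := hpow 2 two_ne_zero
    have hmain : muE f^[m] E = (n : ℕ∞) + 1 ∧
        nuHatE f^[m] E B = (1 + C * B ^ (n + 1)) / ((C * B ^ (n + 1) - 1) * (B - B⁻¹)) := by
      rcases Nat.even_or_odd n with h | h
      · exact hq.indices_of_even hη' hE hn1 hfm hfmE hB0 hC hB h hB21 hY
      · refine hq.indices_of_odd hη' hE hn1 hfm hfmE hB0 hC hB h ?_ hB21 hY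
        exact Even.neg_one_pow (h.add_one.mul_left j)
    have hHmn : Polynomial.aeval (β + β⁻¹) (H (m * (n + 1))) = B ^ (n + 1) + B⁻¹ ^ (n + 1) := by
      rw [aeval_H β hβ0, pow_mul, pow_mul, inv_pow β m]
    have hfinal := sub_ne_zero_and_div_eq hB0 hC hB21 hY (aeval_K B hB0 n)
    rw [hj2, hHmn, hHm]
    refine ⟨?_, fun h => absurd h hmO, fun h => absurd h hmO, fun _ => hmain.1,
      fun h => absurd h hmO, fun _ => ⟨hfinal.1, hmain.2.trans hfinal.2⟩⟩
    rw [hq.isolatedFixedPoints_eq hη' hE hn1 hfm hfmE hB0 hC hB]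
    exact (Finset.finite_toSet _).image q
  · have hmO : Odd m := ⟨j, hj⟩
    have hmE : ¬ Even m := Nat.not_even_iff_odd.2 hmO
    have hfmE : ∀ i : Fin n, Set.MapsTo f^[m] (E i) (E i.rev) := fun i => by
      rw [hj, Function.iterate_succ']
      exact (hfE i).comp (mapsTo_iterate_two_mul hfE j i)
    have hd0 : δ ^ m ≠ 0 := pow_ne_zero _ hδ0
    -- If `δ ^ m = -1`, then `δ ^ (2 * m) = 1`, contrary to the hypothesis on `δ`.
    have hd1 : 1 + δ ^ m ≠ 0 := fun h => hδ (m * 2) (by omega) (by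
      rw [pow_mul, eq_neg_of_add_eq_zero_right h]
      norm_num)
    have hsum : B + B⁻¹ = (1 + δ ^ m) / B := by
      rw [← hB2]
      field_simp
      ring
    have hν : B * (1 + δ ^ m)⁻¹ = 1 / (B + B⁻¹) := by
      rw [hsum, one_div_div, div_eq_mul_inv]
    have hH0 : B + B⁻¹ ≠ 0 := by rw [hsum]; exact div_ne_zero hd1 hB0
    rw [hHm, ← hν]
    rcases Nat.even_or_odd n with h | h
    · obtain ⟨h1, h2, h3⟩ := indices_of_swap_of_even hη' hE hn hfm hfmE hd0 hd1 h B
      exact ⟨h1, fun _ _ => h2, fun _ ho => absurd ho (Nat.not_odd_iff_even.2 h),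
        fun he => absurd he hmE, fun _ => ⟨hH0, h3⟩, fun he => absurd he hmE⟩
    · obtain ⟨h1, h2, h3⟩ := indices_of_swap_of_odd hη' hE hn hfm hfmE hd0 hd1 h B
      exact ⟨h1, fun _ he => absurd he (Nat.not_even_iff_odd.2 h), fun _ _ => h2,
        fun he => absurd he hmE, fun _ => ⟨hH0, h3⟩, fun he => absurd he hmE⟩
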